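/- Let $n\ge 1$ and $\sigma\in[0,1)\cup(1,2]$. Write $\hat f(\xi)=\int_{\mathbb R^n}e^{-ix\cdot\xi}f(x)\,dx$, and $$A_0=\tfrac12\begin{pmatrix}0&-2&-2\\2&0&-2\\1&1&2\end{pmatrix},\qquad A_1=\tfrac12\begin{pmatrix}1&1&0\\1&1&0\\0&0&0\end{pmatrix}.$$ For the thermoelastic plate system $u_{tt}+\Delta^2u+\Delta\theta+(-\Delta)^\sigma u_t=0$, $\theta_t-\Delta\theta-\Delta u_t=0$ with data $(u,u_t,\theta)(0,\cdot)=(u_0,u_1,\theta_0)$, the vector $w=(\hat u_t+|\xi|^2\hat u,\ \hat u_t-|\xi|^2\hat u,\ \hat\theta)^{\mathrm T}$ solves $$w_t+\big(|\xi|^2A_0+|\xi|^{2\sigma}A_1\big)w=0\ (t>0),\qquad w(0,\xi)=w_0(\xi):=(\hat u_1+|\xi|^2\hat u_0,\ \hat u_1-|\xi|^2\hat u_0,\ \hat\theta_0)^{\mathrm T}.$$ Let $v_0=|D|^2u_0$, so that $\hat v_0=|\xi|^2\hat u_0$; the data are $(v_0,u_1,\theta_0)\in\mathcal S(\mathbb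 R^n)^3$. Put $$\|(v_0,u_1,\theta_0)\|_{L^p}=\|v_0\|_{L^p}+\|u_1\|_{L^p}+\|\theta_0\|_{L^p},$$ and for a $\mathbb C^3$-valued $g$ let $\|\chi(D)\mathcal F^{-1}g\|_{\dot H^s_q}=\sum_{j=1}^3\|\mathcal F^{-1}(|\xi|^s\chi g_j)\|_{L^q}$. There is $\varepsilon>0$ depending only on $\sigma$ such that for all $n\ge1$, $s\ge0$, $1\le p\le2\le q\le\infty$ and every real-valued $\chi\in C^\infty(\mathbb R^n)$ supported in $\{|\xi|\le\varepsilon\}$ there is a constant $C>0$ with the following properties for all such data and all $t\ge0$. (i) Let $\sigma\in[0,1)$ and put $$T_0=\begin{pmatrix}-1&0&1\\1&0&1\\0&1&0\end{pmatrix},\quad T_1=I+|\xi|^{2-2\sigma}\begin{pmatrix}0&0&1\\0&0&1\\1&1&0\end{pmatrix},\quad T_{1\frac12}=I+|\xi|^{4-4\sigma}\begin{pmatrix}0&0&0\\0&0&1\\0&1&0\end{pmatrix}.$$ If $\tilde w$ solves $\tilde w_t+\mathrm{diag}(|\xi|^{4-2\sigma},|\xi|^2,|\xi|^{2\sigma})\tilde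 w=0$, $\tilde w(0,\xi)=T_{1\frac12}^{-1}T_1^{-1}T_0^{-1}w_0(\xi)$, then $|\xi|^s\chi(w-T_0T_1T_{1\frac12}\tilde w)(t,\cdot)$ is integrable and $$\big\|\chi(D)\mathcal F^{-1}(w-T_0T_1T_{1\frac12}\tilde w)(t,\cdot)\big\|_{\dot H^s_q}\le C(1+t)^{-\frac{s}{4-2\sigma}-\frac{n}{4-2\sigma}\left(\frac1p-\frac1q\right)-\frac{1-\sigma}{2-\sigma}}\|(v_0,u_1,\theta_0)\|_{L^p}.$$ (ii) Let $\sigma\in(1,2]$, and let $$y_1=\tfrac13(1+z_1),\qquad y_{2,3}=\tfrac13\big(1-\tfrac12z_1\pm\tfrac{\sqrt3}2iz_2\big)$$ be the roots of $y^3-y^2+2y-1=0$, where $$z_{1}=\sqrt[3]{\tfrac{3\sqrt{69}+11}2}-\sqrt[3]{\tfrac{3\sqrt{69}-11}2},\qquad z_{2}=\sqrt[3]{\tfrac{3\sqrt{69}+11}2}+\sqrt[3]{\tfrac{3\sqrt{69}-11}2}.$$ Let $T_0$ be any invertible matrix with $T_0^{-1}A_0T_0=\mathrm{diag}(y_1,y_2,y_3)$.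 If $\tilde w$ solves $\tilde w_t+|\xi|^2\mathrm{diag}(y_1,y_2,y_3)\tilde w=0$, $\tilde w(0,\xi)=T_0^{-1}w_0(\xi)$, then $|\xi|^s\chi(w-T_0\tilde w)(t,\cdot)$ is integrable and $$\big\|\chi(D)\mathcal F^{-1}(w-T_0\tilde w)(t,\cdot)\big\|_{\dot H^s_q}\le C(1+t)^{-\frac s2-\frac n2\left(\frac1p-\frac1q\right)-(\sigma-1)}\|(v_0,u_1,\theta_0)\|_{L^p}.$$ The constant $C$ does not depend on the data, on $t$ or, in (ii), on the choice of $T_0$. -/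

import Mathlib

open MeasureTheory Set Matrix
open scoped FourierTransform SchwartzMap ENNReal ContDiff

noncomputable section

namespace ThermoPlate

/-- The space `ℝⁿ` with its Euclidean norm. -/
abbrev Rn (n : ℕ) : Type := EuclideanSpace ℝ (Fin n)

/-- Fourier transform with the angular-frequency normalisation,
`∫ exp(-i⟨x, ξ⟩) f(x) dx`, for which `-Δ` has the symbol `|ξ|²`. (Mathlib's `𝓕` has the kernel
`exp(-2πi⟨x, η⟩)`, so it is evaluated at `η = ξ / (2π)`.) -/
def angularFourier {n : ℕ} (f : Rn n → ℂ) (ξ : Rn n) : ℂ :=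
  𝓕 f ((2 * Real.pi)⁻¹ • ξ)

/-- The inverse of `angularFourier`, `(2π)⁻ⁿ ∫ exp(i⟨x, ξ⟩) g(ξ) dξ`, written as
`∫ exp(2πi⟨x, η⟩) g(2πη) dη`. -/
def angularFourierInv {n : ℕ} (g : Rn n → ℂ) (x : Rn n) : ℂ :=
  𝓕⁻ (fun η : Rn n => g ((2 * Real.pi) • η)) x

/-- The coefficient matrix `A₀`. -/
def A0 : Matrix (Fin 3) (Fin 3) ℂ :=
  (1 / 2 : ℂ) • !![0, -2, -2; 2, 0, -2; 1, 1, 2]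

/-- The coefficient matrix `A₁`. -/
def A1 : Matrix (Fin 3) (Fin 3) ℂ :=
  (1 / 2 : ℂ) • !![1, 1, 0; 1, 1, 0; 0, 0, 0]

/-- `A(r; σ) = r² A₀ + r^{2σ} A₁`, with `r = |ξ|`. -/
def symbolA (σ r : ℝ) : Matrix (Fin 3) (Fin 3) ℂ :=
  ((r ^ 2 : ℝ) : ℂ) • A0 + ((r ^ (2 * σ) : ℝ) : ℂ) • A1

/-- The initial value `(û₁ + |ξ|² û₀, û₁ - |ξ|² û₀, θ̂₀)`. The argument `v₀` is `|D|² u₀`, so that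
`v̂₀ = |ξ|² û₀`. -/
def initialValue {n : ℕ} (v₀ u₁ θ₀ : Rn n → ℂ) (ξ : Rn n) : Fin 3 → ℂ :=
  ![angularFourier u₁ ξ + angularFourier v₀ ξ,
    angularFourier u₁ ξ - angularFourier v₀ ξ,
    angularFourier θ₀ ξ]

/-- `w` solves `∂ₜ w + M(|ξ|) w = 0` for `t > 0` and every `ξ`, with `w(0, ξ) = w₀(ξ)` attained
continuously. -/
def IsFourierSolution {n : ℕ} (M : ℝ → Matrix (Fin 3) (Fin 3) ℂ)
    (w₀ : Rn n → Fin 3 → ℂ) (w : ℝ → Rn n → Fin 3 → ℂ) : Prop :=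
  ∀ ξ : Rn n,
    w 0 ξ = w₀ ξ ∧
    ContinuousOn (fun t => w t ξ) (Ici 0) ∧
    ∀ t : ℝ, 0 < t → HasDerivAt (fun τ => w τ ξ) (-(M ‖ξ‖ *ᵥ w t ξ)) t

/-- The matrix `T₀` used for `σ ∈ [0, 1)`. -/
def T0 : Matrix (Fin 3) (Fin 3) ℂ :=
  !![-1, 0, 1; 1, 0, 1; 0, 1, 0]

/-- The matrix `T₁ = I + N₁(r)`, with `r = |ξ|`. -/
def T1 (σ r : ℝ) : Matrix (Fin 3) (Fin 3) ℂ :=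
  1 + ((r ^ (2 - 2 * σ) : ℝ) : ℂ) • !![0, 0, 1; 0, 0, 1; 1, 1, 0]

/-- The matrix `T_{1½} = I + N_{1½}(r)`, with `r = |ξ|`. -/
def T1half (σ r : ℝ) : Matrix (Fin 3) (Fin 3) ℂ :=
  1 + ((r ^ (4 - 4 * σ) : ℝ) : ℂ) • !![0, 0, 0; 0, 0, 1; 0, 1, 0]

/-- Symbol of the reference operator for `σ ∈ [0, 1)`:
`diag(r^{4-2σ}, r², r^{2σ})`, with `r = |ξ|`. -/
def refSymbol (σ r : ℝ) : Matrix (Fin 3) (Fin 3) ℂ :=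
  Matrix.diagonal ![((r ^ (4 - 2 * σ) : ℝ) : ℂ), ((r ^ 2 : ℝ) : ℂ), ((r ^ (2 * σ) : ℝ) : ℂ)]

/-- The real number `z₁`. -/
def z1 : ℝ :=
  ((3 * √69 + 11) / 2) ^ (1 / 3 : ℝ) - ((3 * √69 - 11) / 2) ^ (1 / 3 : ℝ)

/-- The real number `z₂`. -/
def z2 : ℝ :=
  ((3 * √69 + 11) / 2) ^ (1 / 3 : ℝ) + ((3 * √69 - 11) / 2) ^ (1 / 3 : ℝ)

/-- The three roots `y₁, y₂, y₃` of `y³ - y² + 2y - 1 = 0`. -/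
def yRoots : Fin 3 → ℂ :=
  ![(1 / 3) * (1 + (z1 : ℂ)),
    (1 / 3) * (1 - (1 / 2) * (z1 : ℂ) + ((√3 : ℝ) : ℂ) / 2 * Complex.I * (z2 : ℂ)),
    (1 / 3) * (1 - (1 / 2) * (z1 : ℂ) - ((√3 : ℝ) : ℂ) / 2 * Complex.I * (z2 : ℂ))]

/-- Symbol of the reference operator for `σ ∈ (1, 2]`: `diag(y₁, y₂, y₃) r²`, with `r = |ξ|`. -/
def refSymbolY (r : ℝ) : Matrix (Fin 3) (Fin 3) ℂ :=
  ((r ^ 2 : ℝ) : ℂ) • Matrix.diagonal yRoots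

/-- `S` diagonalises `A₀`: it is invertible and `S⁻¹ A₀ S = diag(y₁, y₂, y₃)`. -/
def DiagonalizesA0 (S : Matrix (Fin 3) (Fin 3) ℂ) : Prop :=
  IsUnit S.det ∧ S⁻¹ * A0 * S = Matrix.diagonal yRoots

/-- The `j`-th component of `|ξ|^s χ(ξ) g(ξ)`, the Fourier transform of
`|D|^s χ(D) 𝓕⁻¹ g`. -/
def cutoffSymbol {n : ℕ} (s : ℝ) (χ : Rn n → ℝ) (g : Rn n → Fin 3 → ℂ) (j : Fin 3)
    (ξ : Rn n) : ℂ :=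
  ((‖ξ‖ ^ s * χ ξ : ℝ) : ℂ) * g ξ j

/-- The norm `‖χ(D) 𝓕⁻¹ g‖` in `(Ḣ^s_q)³`, i.e. the sum over the three components of
`‖|D|^s χ(D) 𝓕⁻¹ g‖` in `L^q`. -/
def cutoffHomNorm {n : ℕ} (s : ℝ) (q : ℝ≥0∞) (χ : Rn n → ℝ) (g : Rn n → Fin 3 → ℂ) : ℝ≥0∞ :=
  ∑ j : Fin 3, eLpNorm (angularFourierInv (cutoffSymbol s χ g j)) q volume

/-- The norm of the triple `(v₀, u₁, θ₀)` in `L^p × L^p × L^p`. -/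
def dataNorm {n : ℕ} (p : ℝ≥0∞) (v₀ u₁ θ₀ : Rn n → ℂ) : ℝ≥0∞ :=
  eLpNorm v₀ p volume + eLpNorm u₁ p volume + eLpNorm θ₀ p volume

end ThermoPlate

end

/-! ### Lp–Lq bounds for Fourier integrals with Gaussian domination. -/

namespace ThermoPlate

/-! Everything reduces to a pointwise bound in frequency. Since p ≤ 2 ≤ q, no regularity of the
symbol is needed: if |m| ≤ K e^{-2τ|η|²} ∑ |f̂ᵢ|, one factor e^{-τ|η|²} carries f̂ᵢ from L^p data
into L², and the other carries L² to L^q under the Fourier transform. The cost is a power of τ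
(`fourierInv_bound_of_gaussian_domination`). With τ ~ (1+t)^{2/a} this is the decay
(1+t)^{-(n/a)(1/p-1/q)}. A weight r^b e^{-κ r^a t} with a ≥ 2, r ≤ 1 is at most a constant times
(1+t)^{-b/a} e^{-(κ/2)(1+t)^{2/a} r²}, by scaling (`exists_rpow_mul_exp_time_le`). So it suffices to
bound the difference at frequency r = |ξ| by r^γ e^{-κ r^a t} times the data, with γ = 2-2σ, a =
4-2σ in (i) and γ = 2σ-2, a = 2 in (ii).

This bound is an energy estimate in the variables c₁ = (w₂-w₁)/2 = -|ξ|²û, c₂ = θ̂, c₃ = û_t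
(components of w numbered from 1), which are the coordinates of w in the basis given by `T0`. The
coefficients are real, so real and imaginary parts can be treated separately.

(i) With ρ = r^{2σ}, δ = r^{2-2σ}, the system is c₁' = -ρδc₃, c₂' = -ρδ(c₂+c₃), c₃' = -ρc₃ +
ρδ(c₁+c₂); the modes have approximate rates ρδ², ρδ, ρ. An explicit combination of the three
exponentials leaves residuals ρδ³e₁, ρδ²e₂, ρδe₃, up to bounded factors and data. Each, accumulated
over the lifetime of its mode, contributes O(δ). A Lyapunov function with a small cross term damps
c₁, which has no damping of its own, at the slow rate. The profile T₁T_{1½}w̃ differs from that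
combination only by O(δ) (`abs_sub_le_of_weak_system`).

(ii) With β = r², δ = r^{2σ-2}, the friction βδc₃ is a perturbation of the pure A₀ system. The
vector z = T₀w̃ solves that system with z(0) = w(0), so T₀ and the roots disappear from the estimate
and the constant is uniform in T₀. Decay of z and Duhamel-type control of the difference come from
one energy (`abs_sub_le_of_strong_system`).

The solutions are given frequency by frequency, so measurability in ξ is derived from uniqueness: w
is a matrix exponential applied to measurable data. -/

theorem eLpNorm_le_top_rpow_mul_two_rpow {α : Type*} [MeasurableSpace α] {μ : Measure α}
    {F : α → ℂ} (hF : AEStronglyMeasurable F μ) {q : ℝ≥0∞} (hq : 2 ≤ q) :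
    eLpNorm F q μ ≤ eLpNorm F ∞ μ ^ (1 - 2 * (q⁻¹).toReal) *
      eLpNorm F 2 μ ^ (2 * (q⁻¹).toReal) := by
  rcases eq_or_ne q ∞ with rfl | hq'
  · simp
  have hQ : 2 ≤ q.toReal := by
    simpa using ENNReal.toReal_mono hq' hq
  have hq0 : q ≠ 0 := by rintro rfl; simp at hq
  have hQ0 : 0 < q.toReal := by linarith
  rw [eLpNorm_eq_lintegral_rpow_enorm_toReal hq0 hq',
    eLpNorm_eq_lintegral_rpow_enorm_toReal (p := 2) (by simp) (by simp), ENNReal.toReal_inv]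
  have h1 : ∫⁻ x, ‖F x‖ₑ ^ q.toReal ∂μ ≤
      eLpNorm F ∞ μ ^ (q.toReal - 2) * ∫⁻ x, ‖F x‖ₑ ^ (2 : ℝ) ∂μ := by
    rw [← lintegral_const_mul'' _ (by fun_prop)]
    apply lintegral_mono_ae
    rw [eLpNorm_exponent_top]
    filter_upwards [enorm_ae_le_eLpNormEssSup F μ] with x hx
    calc ‖F x‖ₑ ^ q.toReal = ‖F x‖ₑ ^ (q.toReal - 2) * ‖F x‖ₑ ^ (2 : ℝ) := by
          rw [← ENNReal.rpow_add_of_nonneg _ _ (by linarith) (by norm_num), sub_add_cancel]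
      _ ≤ _ := by gcongr
  calc (∫⁻ x, ‖F x‖ₑ ^ q.toReal ∂μ) ^ (1 / q.toReal)
      ≤ (eLpNorm F ∞ μ ^ (q.toReal - 2) * ∫⁻ x, ‖F x‖ₑ ^ (2 : ℝ) ∂μ) ^ (1 / q.toReal) := by
        gcongr
    _ = _ := by
        rw [ENNReal.mul_rpow_of_nonneg _ _ (by positivity), ← ENNReal.rpow_mul,
          ← ENNReal.rpow_mul]
        congr 2
        · field_simp
        · simp [field]

/-- The Gaussian `exp (-τ ‖η‖ ^ 2)`. -/
noncomputable def gauss {E : Type*} [NormedAddCommGroup E] (τ : ℝ) (η : E) : ℂ := (Real.exp (-τ * ‖η‖ ^ 2) : ℝ)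

theorem continuous_gauss {E : Type*} [NormedAddCommGroup E] (τ : ℝ) :
    Continuous (gauss τ : E → ℂ) := by
  unfold gauss; fun_prop

theorem norm_gauss {E : Type*} [NormedAddCommGroup E] (τ : ℝ) (η : E) : ‖gauss τ η‖ = Real.exp (-τ * ‖η‖ ^ 2) := by
  rw [gauss, Complex.norm_real, Real.norm_of_nonneg (Real.exp_pos _).le]

theorem norm_gauss_le_one {E : Type*} [NormedAddCommGroup E] {τ : ℝ}
    (hτ : 0 < τ) (η : E) : ‖gauss τ η‖ ≤ 1 := by
  rw [norm_gauss, Real.exp_le_one_iff]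
  have : 0 ≤ τ * ‖η‖ ^ 2 := by positivity
  linarith

section Fourier

variable {V : Type*} [NormedAddCommGroup V] [InnerProductSpace ℝ V] [FiniteDimensional ℝ V]
  [MeasurableSpace V] [BorelSpace V]

theorem continuous_fourier_of_integrable {m : V → ℂ} (hm : Integrable m) : Continuous (𝓕 m) :=
  VectorFourier.fourierIntegral_continuous Real.continuous_fourierChar
    (by exact continuous_inner) hm

theorem integral_fourier_mul_eq_of_integrable {f g : V → ℂ} (hf : Integrable f)
    (hg : Integrable g) : ∫ ξ, 𝓕 f ξ * g ξ = ∫ x, f x * 𝓕 g x := by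
  simpa using! VectorFourier.integral_fourierIntegral_smul_eq_flip (L := innerₗ V)
    Real.continuous_fourierChar continuous_inner hf hg

/-- Plancherel for the Fourier integral itself: on L¹ ∩ L² it agrees almost everywhere with the
abstract L² transform, because both have the same pairing with smooth compactly supported functions.
-/
theorem eLpNorm_fourier_two {m : V → ℂ} (hm : Integrable m) (hm2 : MemLp m 2) :
    eLpNorm (𝓕 m) 2 volume = eLpNorm m 2 volume := by
  set h : Lp ℂ 2 (volume : Measure V) := hm2.toLp m
  have hc : Continuous (𝓕 m) := continuous_fourier_of_integrable hm
  have key : (𝓕 h : Lp ℂ 2 (volume : Measure V)) =ᵐ[volume] 𝓕 m := by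
    apply ae_eq_of_integral_contDiff_smul_eq
    · exact (Lp.memLp _).locallyIntegrable (by norm_num)
    · exact hc.locallyIntegrable
    · intro g hg hgs
      set G : 𝓢(V, ℂ) := (hgs.comp_left (g := fun x : ℝ => (x : ℂ)) (by simp)).toSchwartzMap
        (Complex.ofRealCLM.contDiff.comp hg) with hG
      have hGc : ∀ x, G x = (g x : ℂ) := fun x => rfl
      have e1 := DFunLike.congr_fun (Lp.fourier_toTemperedDistribution_eq h) G
      rw [TemperedDistribution.fourier_apply, Lp.toTemperedDistribution_apply,
        Lp.toTemperedDistribution_apply] at e1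
      have e2 : ∫ x, (𝓕 G : 𝓢(V, ℂ)) x • h x = ∫ x, 𝓕 (G : V → ℂ) x * m x := by
        apply integral_congr_ae
        filter_upwards [hm2.coeFn_toLp] with x hx
        rw [smul_eq_mul, show h x = m x from hx, SchwartzMap.fourier_coe]
      rw [e2, integral_fourier_mul_eq_of_integrable G.integrable hm] at e1
      simpa [hGc] using e1.symm
  rw [← eLpNorm_congr_ae key, ← eLpNorm_congr_ae hm2.coeFn_toLp]
  have := Lp.norm_fourier_eq h
  rw [Lp.norm_def, Lp.norm_def] at this
  exact (ENNReal.toReal_eq_toReal_iff' (Lp.eLpNorm_ne_top _) (Lp.eLpNorm_ne_top _)).1 this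

theorem eLpNorm_fourier_top_le (m : V → ℂ) :
    eLpNorm (𝓕 m) ∞ volume ≤ eLpNorm m 1 volume := by
  rw [eLpNorm_exponent_top]
  apply eLpNormEssSup_le_of_ae_enorm_bound
  refine Filter.Eventually.of_forall fun x => ?_
  rw [Real.fourier_eq, eLpNorm_one_eq_lintegral_enorm]
  refine (enorm_integral_le_lintegral_enorm _).trans_eq ?_
  congr 1 with y
  rw [Circle.smul_def, smul_eq_mul, enorm_mul, ← ofReal_norm, Circle.norm_coe]
  simp

theorem eLpNorm_gauss_two {τ : ℝ} (hτ : 0 < τ) :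
    eLpNorm (gauss τ : V → ℂ) 2 volume =
      ENNReal.ofReal ((Real.pi / (2 * τ)) ^ (Module.finrank ℝ V / 4 : ℝ)) := by
  have hI := GaussianFourier.integral_rexp_neg_mul_sq_norm (V := V) (b := 2 * τ) (by positivity)
  have hint : Integrable (fun v : V => Real.exp (-(2 * τ) * ‖v‖ ^ 2)) := by
    by_contra h
    rw [integral_undef h] at hI
    have : (0 : ℝ) < (Real.pi / (2 * τ)) ^ (Module.finrank ℝ V / 2 : ℝ) := by positivity
    linarith
  rw [eLpNorm_eq_lintegral_rpow_enorm_toReal (by simp) (by simp)]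
  have e : ∀ x : V, ‖gauss τ x‖ₑ ^ (2 : ℝ≥0∞).toReal =
      ENNReal.ofReal (Real.exp (-(2 * τ) * ‖x‖ ^ 2)) := by
    intro x
    rw [← ofReal_norm, norm_gauss, ENNReal.ofReal_rpow_of_nonneg (by positivity) (by simp),
      ← Real.exp_mul]
    congr 2
    simp; ring
  simp_rw [e]
  rw [← ofReal_integral_eq_lintegral_ofReal hint (by filter_upwards with x; positivity), hI,
    ENNReal.ofReal_rpow_of_nonneg (by positivity) (by simp), ← Real.rpow_mul (by positivity)]
  congr 2
  simp; ring

theorem memLp_gauss_two {τ : ℝ} (hτ : 0 < τ) : MemLp (gauss τ : V → ℂ) 2 volume :=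
  ⟨(continuous_gauss τ).aestronglyMeasurable, by rw [eLpNorm_gauss_two hτ]; simp⟩

theorem integrable_gauss_mul {τ : ℝ} (hτ : 0 < τ) {h : V → ℂ} (hh : MemLp h 2) :
    Integrable (fun η => gauss τ η * h η) :=
  (memLp_gauss_two hτ).integrable_mul hh

theorem memLp_gauss_mul {τ : ℝ} (hτ : 0 < τ) {h : V → ℂ} (hh : MemLp h 2) :
    MemLp (fun η => gauss τ η * h η) 2 :=
  hh.mono ((continuous_gauss τ).aestronglyMeasurable.mul hh.1)
    (Filter.Eventually.of_forall fun x => by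
      rw [norm_mul]
      exact mul_le_of_le_one_left (norm_nonneg _) (norm_gauss_le_one hτ x))

/-- Interpolation between q = 2, where the Gaussian is at most 1 and Plancherel applies, and q = ∞,
where Hölder costs the L² norm of the Gaussian. -/
theorem eLpNorm_fourier_gauss_mul_le {τ : ℝ} (hτ : 0 < τ) {h : V → ℂ} (hh : MemLp h 2)
    {q : ℝ≥0∞} (hq : 2 ≤ q) :
    eLpNorm (𝓕 (fun η => gauss τ η * h η)) q volume ≤
      ENNReal.ofReal ((Real.pi / (2 * τ)) ^
        ((Module.finrank ℝ V / 2 : ℝ) * (1 / 2 - (q⁻¹).toReal))) * eLpNorm h 2 volume := by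
  have hi := integrable_gauss_mul hτ hh
  have h2 := memLp_gauss_mul hτ hh
  have hq1 : (q⁻¹).toReal ≤ 1 / 2 := by
    have := ENNReal.toReal_mono (by simp) (ENNReal.inv_le_inv.2 hq)
    simpa using this
  have hq0 : 0 ≤ (q⁻¹).toReal := ENNReal.toReal_nonneg
  have a1 : eLpNorm (𝓕 (fun η => gauss τ η * h η)) 2 volume ≤ eLpNorm h 2 volume := by
    rw [eLpNorm_fourier_two hi h2]
    refine eLpNorm_mono fun x => ?_
    rw [norm_mul]
    exact mul_le_of_le_one_left (norm_nonneg _) (norm_gauss_le_one hτ x)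
  have a2 : eLpNorm (𝓕 (fun η => gauss τ η * h η)) ∞ volume ≤
      ENNReal.ofReal ((Real.pi / (2 * τ)) ^ (Module.finrank ℝ V / 4 : ℝ)) *
        eLpNorm h 2 volume := by
    refine (eLpNorm_fourier_top_le _).trans ?_
    rw [← eLpNorm_gauss_two hτ]
    have := eLpNorm_smul_le_mul_eLpNorm (p := 2) (q := 2) (r := 1) hh.1 (memLp_gauss_two hτ).1
    simp only [smul_eq_mul] at this
    exact this
  refine (eLpNorm_le_top_rpow_mul_two_rpow
    (continuous_fourier_of_integrable hi).aestronglyMeasurable hq).trans ?_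
  calc _ ≤ (ENNReal.ofReal ((Real.pi / (2 * τ)) ^ (Module.finrank ℝ V / 4 : ℝ)) *
        eLpNorm h 2 volume) ^ (1 - 2 * (q⁻¹).toReal) *
          eLpNorm h 2 volume ^ (2 * (q⁻¹).toReal) := by
        gcongr
        linarith
    _ = _ := by
        rw [ENNReal.mul_rpow_of_nonneg _ _ (by linarith), mul_assoc,
          ← ENNReal.rpow_add_of_nonneg _ _ (by linarith) (by linarith),
          ENNReal.ofReal_rpow_of_nonneg (by positivity) (by linarith),
          ← Real.rpow_mul (by positivity)]
        simp only [sub_add_cancel, ENNReal.rpow_one]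
        congr 3
        ring

theorem eLpNorm_two_mul_self {α : Type*} [MeasurableSpace α] {μ : Measure α} (h : α → ℂ) :
    eLpNorm h 2 μ * eLpNorm h 2 μ = ∫⁻ x, ‖h x‖ₑ ^ 2 ∂μ := by
  rw [eLpNorm_eq_lintegral_rpow_enorm_toReal (by simp) (by simp),
    ← ENNReal.rpow_add_of_nonneg _ _ (by simp) (by simp)]
  norm_num

theorem memLp_fourier_schwartz (f : 𝓢(V, ℂ)) : MemLp (𝓕 (f : V → ℂ)) 2 volume := by
  rw [← SchwartzMap.fourier_coe]
  exact SchwartzMap.memLp _ 2 _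

/-- The dual of the preceding bound. For H the Gaussian times f̂, ‖H‖₂² = ∫ f̂ · (Gaussian · H̄);
moving the transform onto the second factor and applying Hölder with p' ≥ 2 leaves one factor ‖H‖₂
to cancel. -/
theorem eLpNorm_gauss_mul_fourier_le {τ : ℝ} (hτ : 0 < τ) (f : 𝓢(V, ℂ))
    {p : ℝ≥0∞} (hp1 : 1 ≤ p) (hp : p ≤ 2) :
    eLpNorm (fun η => gauss τ η * 𝓕 (f : V → ℂ) η) 2 volume ≤
      ENNReal.ofReal ((Real.pi / (2 * τ)) ^
        ((Module.finrank ℝ V / 2 : ℝ) * ((p⁻¹).toReal - 1 / 2))) * eLpNorm f p volume := by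
  set H : V → ℂ := fun η => gauss τ η * 𝓕 (f : V → ℂ) η with hH
  have hH2 : MemLp H 2 volume := memLp_gauss_mul hτ (memLp_fourier_schwartz f)
  set K : V → ℂ := fun η => starRingEnd ℂ (H η) with hK
  have hKn : ∀ x, ‖K x‖ = ‖H x‖ := fun x => RCLike.norm_conj _
  have hK2 : MemLp K 2 volume :=
    hH2.congr_norm (Complex.continuous_conj.comp_aestronglyMeasurable hH2.1)
      (Filter.Eventually.of_forall fun x => (hKn x).symm)
  have hKe : eLpNorm K 2 volume = eLpNorm H 2 volume :=
    eLpNorm_congr_norm_ae (Filter.Eventually.of_forall hKn)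
  have hconj : p.HolderConjugate p.conjExponent := ENNReal.HolderConjugate.conjExponent hp1
  have hp'inv : p.conjExponent⁻¹ = 1 - p⁻¹ := by
    have := hconj.inv_add_inv_eq_one
    rw [← this, ENNReal.add_sub_cancel_left]
    simp; rintro rfl; simp at hp1
  have hpinv : p⁻¹ ≤ 1 := ENNReal.inv_le_one.2 hp1
  have hpinv2 : 2⁻¹ ≤ p⁻¹ := ENNReal.inv_le_inv.2 hp
  have hp' : 2 ≤ p.conjExponent := by
    rw [← ENNReal.inv_le_inv, hp'inv]
    calc 1 - p⁻¹ ≤ 1 - 2⁻¹ := tsub_le_tsub_left hpinv2 _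
      _ = 2⁻¹ := ENNReal.one_sub_inv_two
  have hp'real : 1 / 2 - (p.conjExponent⁻¹).toReal = (p⁻¹).toReal - 1 / 2 := by
    rw [hp'inv, ENNReal.toReal_sub_of_le hpinv (by simp)]
    simp; ring
  have hb := eLpNorm_fourier_gauss_mul_le hτ hK2 hp'
  rw [hp'real, hKe] at hb
  set c := ENNReal.ofReal ((Real.pi / (2 * τ)) ^
        ((Module.finrank ℝ V / 2 : ℝ) * ((p⁻¹).toReal - 1 / 2)))
  have hi := integrable_gauss_mul hτ hK2
  have hswap := integral_fourier_mul_eq_of_integrable f.integrable hi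
  have hsq : ∀ η, 𝓕 (f : V → ℂ) η * (gauss τ η * K η) = ((‖H η‖ ^ 2 : ℝ) : ℂ) := by
    intro η
    rw [← mul_assoc, mul_comm (𝓕 (f : V → ℂ) η), hK]
    simp only
    rw [show gauss τ η * 𝓕 (f : V → ℂ) η = H η from rfl, Complex.mul_conj, Complex.normSq_eq_norm_sq]
  simp_rw [hsq] at hswap
  rw [integral_complex_ofReal] at hswap
  have key : eLpNorm H 2 volume * eLpNorm H 2 volume ≤
      (c * eLpNorm f p volume) * eLpNorm H 2 volume := by
    have hHint : Integrable (fun x => ‖H x‖ ^ 2) := (memLp_two_iff_integrable_sq_norm hH2.1).1 hH2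
    calc eLpNorm H 2 volume * eLpNorm H 2 volume = ∫⁻ x, ‖H x‖ₑ ^ 2 :=
          eLpNorm_two_mul_self H
      _ = ∫⁻ x, ENNReal.ofReal (‖H x‖ ^ 2) := by
          congr 1 with x
          rw [ENNReal.ofReal_pow (norm_nonneg _), ofReal_norm]
      _ = ENNReal.ofReal (∫ x, ‖H x‖ ^ 2) :=
          (ofReal_integral_eq_lintegral_ofReal hHint (by filter_upwards with x; positivity)).symm
      _ = ‖(((∫ x, ‖H x‖ ^ 2 : ℝ)) : ℂ)‖ₑ := by
          rw [← ofReal_norm, Complex.norm_real, Real.norm_of_nonneg (by positivity)]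
      _ = ‖∫ x, f x * 𝓕 (fun η => gauss τ η * K η) x‖ₑ := by rw [← hswap]
      _ ≤ ∫⁻ x, ‖f x * 𝓕 (fun η => gauss τ η * K η) x‖ₑ := enorm_integral_le_lintegral_enorm _
      _ = eLpNorm (fun x => f x * 𝓕 (fun η => gauss τ η * K η) x) 1 volume :=
          eLpNorm_one_eq_lintegral_enorm.symm
      _ ≤ eLpNorm f p volume * eLpNorm (𝓕 (fun η => gauss τ η * K η)) p.conjExponent volume := by
          have := eLpNorm_smul_le_mul_eLpNorm (p := p) (q := p.conjExponent) (r := 1)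
            (continuous_fourier_of_integrable hi).aestronglyMeasurable
            (f.continuous.aestronglyMeasurable (μ := volume))
          simp only [smul_eq_mul] at this
          exact this
      _ ≤ eLpNorm f p volume * (c * eLpNorm H 2 volume) := by gcongr
      _ = _ := by ring
  rcases eq_or_ne (eLpNorm H 2 volume) 0 with h0 | h0
  · rw [h0]; positivity
  · exact (ENNReal.mul_le_mul_iff_left h0 hH2.2.ne).1 key

theorem eLpNorm_fourierInv_eq (m : V → ℂ) (hm : Integrable m) (q : ℝ≥0∞) :
    eLpNorm (𝓕⁻ m) q volume = eLpNorm (𝓕 m) q volume := by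
  have : 𝓕⁻ m = 𝓕 m ∘ (fun x => -x) := by
    ext x; exact Real.fourierInv_eq_fourier_neg m x
  rw [this, eLpNorm_comp_measurePreserving
    (continuous_fourier_of_integrable hm).aestronglyMeasurable (Measure.measurePreserving_neg _)]

theorem fourierInv_bound_of_gaussian_domination {ι : Type*} [Fintype ι] {τ : ℝ} (hτ : 0 < τ)
    (f : ι → 𝓢(V, ℂ)) {m : V → ℂ} (hm : AEStronglyMeasurable m volume) {K : ℝ} (hK : 0 ≤ K)
    (hb : ∀ᵐ η : V, ‖m η‖ ≤ K * Real.exp (-(2 * τ) * ‖η‖ ^ 2) * ∑ i, ‖𝓕 (f i : V → ℂ) η‖)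
    {p q : ℝ≥0∞} (hp1 : 1 ≤ p) (hp : p ≤ 2) (hq : 2 ≤ q) :
    Integrable m ∧ eLpNorm (𝓕⁻ m) q volume ≤
      ENNReal.ofReal (K * (Real.pi / (2 * τ)) ^
        ((Module.finrank ℝ V / 2 : ℝ) * ((p⁻¹).toReal - (q⁻¹).toReal))) *
        ∑ i, eLpNorm (f i) p volume := by
  -- Half of the Gaussian decay is taken out of m, to be spent on L² → L^q; what is left in h is
  -- spent on L^p → L².
  set h : V → ℂ := fun η => gauss (-τ) η * m η with hh
  have hgg : ∀ η : V, gauss τ η * gauss (-τ) η = 1 := by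
    intro η
    simp only [gauss]
    rw [← Complex.ofReal_mul, ← Real.exp_add]
    simp
  have hm' : m = fun η => gauss τ η * h η := by
    ext η
    rw [hh, ← mul_assoc, hgg, one_mul]
  have hhb : ∀ᵐ η : V, ‖h η‖ ≤ ∑ i, K * ‖gauss τ η * 𝓕 (f i : V → ℂ) η‖ := by
    filter_upwards [hb] with η hη
    rw [hh, norm_mul, norm_gauss]
    simp_rw [norm_mul, norm_gauss]
    rw [← Finset.mul_sum, ← Finset.mul_sum]
    calc _ ≤ Real.exp (- -τ * ‖η‖ ^ 2) *
          (K * Real.exp (-(2 * τ) * ‖η‖ ^ 2) * ∑ i, ‖𝓕 (f i : V → ℂ) η‖) := by gcongr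
      _ = K * (Real.exp (- -τ * ‖η‖ ^ 2) * Real.exp (-(2 * τ) * ‖η‖ ^ 2)) *
          ∑ i, ‖𝓕 (f i : V → ℂ) η‖ := by ring
      _ = _ := by
          rw [← Real.exp_add, mul_assoc]; congr 4; ring
  have hhm : AEStronglyMeasurable h volume := (continuous_gauss _).aestronglyMeasurable.mul hm
  have hfm : ∀ i, MemLp (fun η => gauss τ η * 𝓕 (f i : V → ℂ) η) 2 volume := fun i =>
    memLp_gauss_mul hτ (memLp_fourier_schwartz (f i))
  have hhn : eLpNorm h 2 volume ≤
      ∑ i, ENNReal.ofReal K * eLpNorm (fun η => gauss τ η * 𝓕 (f i : V → ℂ) η) 2 volume := by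
    calc eLpNorm h 2 volume
        ≤ eLpNorm (∑ i, fun η => K * ‖gauss τ η * 𝓕 (f i : V → ℂ) η‖) 2 volume := by
          refine eLpNorm_mono_ae_real ?_
          filter_upwards [hhb] with η hη
          simpa using hη
      _ ≤ ∑ i, eLpNorm (fun η => K * ‖gauss τ η * 𝓕 (f i : V → ℂ) η‖) 2 volume :=
          eLpNorm_sum_le (fun i _ => (hfm i).1.norm.const_mul K) (by norm_num)
      _ = _ := by
          refine Finset.sum_congr rfl fun i _ => ?_
          have := eLpNorm_const_smul K (fun η : V => ‖gauss τ η * 𝓕 (f i : V → ℂ) η‖) 2 volume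
          rw [eLpNorm_norm, Real.enorm_eq_ofReal hK] at this
          exact this
  have hh2 : MemLp h 2 volume := by
    refine ⟨hhm, hhn.trans_lt ?_⟩
    exact ENNReal.sum_lt_top.2 fun i _ => ENNReal.mul_lt_top (by simp) (hfm i).2
  have hi : Integrable m := by rw [hm']; exact integrable_gauss_mul hτ hh2
  refine ⟨hi, ?_⟩
  rw [eLpNorm_fourierInv_eq m hi]
  conv_lhs => rw [hm']
  refine (eLpNorm_fourier_gauss_mul_le hτ hh2 hq).trans ?_
  have hpos : 0 < Real.pi / (2 * τ) := by positivity
  calc _ ≤ ENNReal.ofReal ((Real.pi / (2 * τ)) ^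
        ((Module.finrank ℝ V / 2 : ℝ) * (1 / 2 - (q⁻¹).toReal))) *
        ∑ i, ENNReal.ofReal K * (ENNReal.ofReal ((Real.pi / (2 * τ)) ^
        ((Module.finrank ℝ V / 2 : ℝ) * ((p⁻¹).toReal - 1 / 2))) * eLpNorm (f i) p volume) := by
        gcongr
        refine hhn.trans ?_
        gcongr with i
        exact eLpNorm_gauss_mul_fourier_le hτ (f i) hp1 hp
    _ = _ := by
        rw [← Finset.mul_sum, ← Finset.mul_sum, ← mul_assoc, ← mul_assoc,
          mul_comm _ (ENNReal.ofReal K), mul_assoc (ENNReal.ofReal K),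
          ← ENNReal.ofReal_mul (by positivity), ← ENNReal.ofReal_mul hK, ← Real.rpow_add hpos]
        congr 4
        ring

end Fourier

/-! ### Gronwall inequality and energy estimate for weak damping. -/

/-- Gronwall with a variable rate g' and a source written as k' e^{-g}: multiplying by the
integrating factor makes e^g L - k nonincreasing. A bounded g - λt still yields decay at rate λ. -/
theorem exp_mul_sub_le_of_deriv_le {L L' g g' k k' : ℝ → ℝ} (hL : ContinuousOn L (Ici 0))
    (hg : ContinuousOn g (Ici 0)) (hk : ContinuousOn k (Ici 0))
    (hL' : ∀ t, 0 < t → HasDerivAt L (L' t) t) (hg' : ∀ t, 0 < t → HasDerivAt g (g' t) t)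
    (hk' : ∀ t, 0 < t → HasDerivAt k (k' t) t)
    (h : ∀ t, 0 < t → L' t + g' t * L t ≤ k' t * Real.exp (-g t)) {t : ℝ} (ht : 0 ≤ t) :
    Real.exp (g t) * L t - k t ≤ Real.exp (g 0) * L 0 - k 0 := by
  have hd : ∀ t, 0 < t → HasDerivAt (fun t => Real.exp (g t) * L t - k t)
      (Real.exp (g t) * g' t * L t + Real.exp (g t) * L' t - k' t) t := fun t ht =>
    (((hg' t ht).exp).mul (hL' t ht)).sub (hk' t ht)
  have hanti : AntitoneOn (fun t => Real.exp (g t) * L t - k t) (Ici 0) := by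
    apply antitoneOn_of_deriv_nonpos (convex_Ici 0)
    · exact ((Real.continuous_exp.comp_continuousOn hg).mul hL).sub hk
    · intro x hx
      rw [interior_Ici] at hx
      exact (hd x hx).differentiableAt.differentiableWithinAt
    · intro x hx
      rw [interior_Ici] at hx
      rw [(hd x hx).deriv]
      have h1 := mul_le_mul_of_nonneg_left (h x hx) (Real.exp_pos (g x)).le
      have h2 : Real.exp (g x) * (k' x * Real.exp (-g x)) = k' x := by
        rw [mul_left_comm, ← Real.exp_add]; simp
      rw [h2] at h1
      linarith
  exact hanti (by simp) ht ht

theorem real_eq_exp_mul_of_hasDerivAt {f : ℝ → ℝ} {l : ℝ} (hf : ContinuousOn f (Ici 0))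
    (hf' : ∀ t, 0 < t → HasDerivAt f (-(l * f t)) t) {t : ℝ} (ht : 0 ≤ t) :
    f t = Real.exp (-(l * t)) * f 0 := by
  have aux : ∀ u : ℝ → ℝ, ContinuousOn u (Ici 0) → (∀ t, 0 < t → HasDerivAt u (-(l * u t)) t) →
      Real.exp (l * t) * u t ≤ u 0 := by
    intro u hu hu'
    have := exp_mul_sub_le_of_deriv_le (g := fun t => l * t) (g' := fun _ => l) (k := fun _ => 0)
      (k' := fun _ => 0) hu (by fun_prop) (by fun_prop) hu'
      (fun t _ => by simpa using (hasDerivAt_id t).const_mul l) (fun t _ => hasDerivAt_const _ _)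
      (fun t _ => by simp) ht
    simpa using this
  have h1 := aux f hf hf'
  have h2 := aux (fun t => -f t) hf.neg (fun t ht => by
    have := (hf' t ht).fun_neg
    simpa using this)
  have h3 : Real.exp (l * t) * f t = f 0 := by linarith
  rw [← h3, ← mul_assoc, ← Real.exp_add]
  simp

theorem hasDerivAt_exp_neg_mul (l t : ℝ) :
    HasDerivAt (fun t => Real.exp (-(l * t))) (-(l * Real.exp (-(l * t)))) t := by
  have := (((hasDerivAt_id t).const_mul l).fun_neg).exp
  simp only [id, mul_one] at this
  exact this.congr_deriv (by ring)

/-- The dissipation inequality for the Lyapunov function `|E|² / 2 - δ E₁ E₃ / 4`, with a forcing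
term whose three modes decay at the rates `δ²`, `δ` and `1`. -/
theorem lyapunov_deriv_le_weak {δ a₁ a₂ a₃ e₁ e₂ e₃ E₁ E₂ E₃ M : ℝ} (hδ : 0 < δ) (hδ1 : δ ≤ 1 / 4)
    (h₁ : |a₁| ≤ M) (h₂ : |a₂| ≤ M) (h₃ : |a₃| ≤ M) (he₂ : 0 ≤ e₂) (he₃ : 0 ≤ e₃) :
    (E₁ - δ / 4 * E₃) * (-(δ * E₃) + (δ ^ 3 * a₁ * e₁ - δ ^ 2 * a₂ * e₂ - δ * a₃ * e₃)) +
      E₂ * (-(δ * (E₂ + E₃)) - (δ ^ 2 * a₂ * e₂ + δ * a₃ * e₃)) +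
      (E₃ - δ / 4 * E₁) * (-E₃ + δ * (E₁ + E₂) +
        ((δ ^ 3 - δ ^ 4) * a₁ * e₁ + δ ^ 2 * a₂ * e₂)) ≤
    (-(δ ^ 2 / 16) + 12 * δ * e₂ + 12 * e₃) *
      ((E₁ ^ 2 + E₂ ^ 2 + E₃ ^ 2) / 2 - δ / 4 * (E₁ * E₃)) +
      16 * M ^ 2 * (δ ^ 4 * e₁ ^ 2 + δ ^ 3 * e₂ + δ ^ 2 * e₃) := by
  have hsq : ∀ a : ℝ, |a| ≤ M → a ^ 2 ≤ M ^ 2 := fun a ha => by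
    rw [← sq_abs]; gcongr
  have s₁ := hsq _ h₁
  have s₂ := hsq _ h₂
  have s₃ := hsq _ h₃
  obtain ⟨S, hS⟩ : ∃ S, S = E₁ ^ 2 + E₂ ^ 2 + E₃ ^ 2 := ⟨_, rfl⟩
  obtain ⟨Y, hY⟩ : ∃ Y, Y = (E₁ ^ 2 + E₂ ^ 2 + E₃ ^ 2) / 2 - δ / 4 * (E₁ * E₃) := ⟨_, rfl⟩
  have hS0 : 0 ≤ S := by rw [hS]; positivity
  have hcross : |δ / 4 * (E₁ * E₃)| ≤ S / 8 := by
    have hδE : 0 ≤ (1 / 4 - δ) * (E₁ ^ 2 + E₃ ^ 2) := mul_nonneg (by linarith) (by positivity)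
    rw [abs_le, hS]
    constructor <;>
    linarith [hδE, mul_nonneg hδ.le (sq_nonneg (E₁ + E₃)), mul_nonneg hδ.le (sq_nonneg (E₁ - E₃)),
      sq_nonneg E₁, sq_nonneg E₂, sq_nonneg E₃]
  obtain ⟨hc1, hc2⟩ := abs_le.1 hcross
  have hYS : Y ≤ S := by rw [hY]; linarith
  have hSY : S ≤ 4 * Y := by rw [hY]; linarith
  obtain ⟨G₁, hG₁⟩ : ∃ G, G = E₁ - δ / 4 * E₃ := ⟨_, rfl⟩
  obtain ⟨G₃, hG₃⟩ : ∃ G, G = E₃ - δ / 4 * E₁ := ⟨_, rfl⟩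
  have hG : G₁ ^ 2 + E₂ ^ 2 + G₃ ^ 2 ≤ 2 * S := by
    have : G₁ ^ 2 + E₂ ^ 2 + G₃ ^ 2 = S - 4 * (δ / 4 * (E₁ * E₃)) +
      δ ^ 2 / 16 * (E₁ ^ 2 + E₃ ^ 2) := by rw [hG₁, hG₃, hS]; ring
    rw [this]
    have hd2 : δ ^ 2 ≤ 1 := by nlinarith
    have := mul_nonneg (sub_nonneg.2 hd2) (add_nonneg (sq_nonneg E₁) (sq_nonneg E₃))
    linarith [sq_nonneg E₂]
  have hP₁ : (G₁ + (1 - δ) * G₃) ^ 2 ≤ 4 * S := by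
    have h1 : (G₁ + (1 - δ) * G₃) ^ 2 ≤ 2 * G₁ ^ 2 + 2 * ((1 - δ) * G₃) ^ 2 := by
      linarith [sq_nonneg (G₁ - (1 - δ) * G₃)]
    have h2 : ((1 - δ) * G₃) ^ 2 ≤ G₃ ^ 2 := by
      rw [mul_pow]
      exact mul_le_of_le_one_left (sq_nonneg _) (by nlinarith)
    linarith [sq_nonneg E₂]
  have hP₂ : (-G₁ - E₂ + G₃) ^ 2 ≤ 6 * S := by
    linarith [sq_nonneg (G₁ - E₂), sq_nonneg (G₁ + G₃),
      sq_nonneg (E₂ + G₃)]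
  have hP₃ : (-G₁ - E₂) ^ 2 ≤ 4 * S := by
    linarith [sq_nonneg (G₁ - E₂), sq_nonneg G₃]
  -- The slow forcing is absorbed by half of the dissipation δ²S/8 proved below.
  have f₁ : δ ^ 3 * a₁ * e₁ * (G₁ + (1 - δ) * G₃) ≤ δ ^ 2 * S / 16 + 16 * δ ^ 4 * M ^ 2 * e₁ ^ 2 := by
    have h1 : δ ^ 3 * a₁ * e₁ * (G₁ + (1 - δ) * G₃) ≤
        δ ^ 2 * (G₁ + (1 - δ) * G₃) ^ 2 / 64 + 16 * δ ^ 4 * (a₁ ^ 2) * e₁ ^ 2 := by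
      linarith [sq_nonneg (δ * (G₁ + (1 - δ) * G₃) / 8 - 4 * δ ^ 2 * a₁ * e₁)]
    have h2 : 16 * δ ^ 4 * (a₁ ^ 2) * e₁ ^ 2 ≤ 16 * δ ^ 4 * M ^ 2 * e₁ ^ 2 := by gcongr
    have h3 : δ ^ 2 * (G₁ + (1 - δ) * G₃) ^ 2 ≤ δ ^ 2 * (4 * S) := by gcongr
    linarith
  -- Here and for e₃ the dissipation is too weak for Young's inequality, so one factor eᵢ is kept
  -- outside: the energy term acquires a coefficient integrable in time, which Gronwall tolerates.
  have f₂ : δ ^ 2 * a₂ * e₂ * (-G₁ - E₂ + G₃) ≤ e₂ * (3 * δ * S + 16 * δ ^ 3 * M ^ 2) := by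
    have h1 : δ ^ 2 * a₂ * (-G₁ - E₂ + G₃) ≤
        δ * (-G₁ - E₂ + G₃) ^ 2 / 2 + δ ^ 3 * (a₂ ^ 2) / 2 := by
      linarith [mul_nonneg hδ.le (sq_nonneg ((-G₁ - E₂ + G₃) - δ * a₂))]
    have h2 : δ ^ 3 * (a₂ ^ 2) ≤ δ ^ 3 * M ^ 2 := by gcongr
    have h3 : δ * (-G₁ - E₂ + G₃) ^ 2 ≤ δ * (6 * S) := by gcongr
    have h4 : 0 ≤ δ ^ 3 * M ^ 2 := by positivity
    have h5 : δ ^ 2 * a₂ * (-G₁ - E₂ + G₃) ≤ 3 * δ * S + 16 * δ ^ 3 * M ^ 2 := by linarith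
    have := mul_le_mul_of_nonneg_left h5 he₂
    linarith
  have f₃ : δ * a₃ * e₃ * (-G₁ - E₂) ≤ e₃ * (2 * S + 16 * δ ^ 2 * M ^ 2) := by
    have h1 : δ * a₃ * (-G₁ - E₂) ≤ (-G₁ - E₂) ^ 2 / 2 + δ ^ 2 * (a₃ ^ 2) / 2 := by
      linarith [sq_nonneg ((-G₁ - E₂) - δ * a₃)]
    have h2 : δ ^ 2 * (a₃ ^ 2) ≤ δ ^ 2 * M ^ 2 := by gcongr
    have h4 : 0 ≤ δ ^ 2 * M ^ 2 := by positivity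
    have h5 : δ * a₃ * (-G₁ - E₂) ≤ 2 * S + 16 * δ ^ 2 * M ^ 2 := by linarith
    have := mul_le_mul_of_nonneg_left h5 he₃
    linarith
  -- The skew couplings cancel; E₂ and E₃ are damped directly, and the cross term supplies -δ²E₁²/4.
  have hdiss : G₁ * (-(δ * E₃)) + E₂ * (-(δ * (E₂ + E₃))) + G₃ * (-E₃ + δ * (E₁ + E₂)) ≤
      -(δ ^ 2 / 8) * S := by
    have h1 : 0 ≤ δ * E₂ ^ 2 * (1 / 4 - δ) := mul_nonneg (by positivity) (by linarith)
    have h3 : 0 ≤ E₃ ^ 2 * (1 / 16 - δ ^ 2) := mul_nonneg (by positivity) (by nlinarith)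
    rw [hG₁, hG₃, hS]
    linarith [sq_nonneg (δ * E₁ / 4 - E₃ / 2), sq_nonneg (δ * E₁ / 4 + δ * E₂ / 2),
      mul_nonneg hδ.le (sq_nonneg E₂), sq_nonneg E₃]
  have g₁ : δ ^ 2 / 16 * Y ≤ δ ^ 2 / 16 * S := by gcongr
  have g₂ : e₂ * (3 * δ * S) ≤ e₂ * (3 * δ * (4 * Y)) := by gcongr
  have g₃ : e₃ * (2 * S) ≤ e₃ * (2 * (4 * Y)) := by gcongr
  have g₄ : 0 ≤ e₃ * Y := mul_nonneg he₃ (by linarith)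
  rw [← hG₁, ← hG₃, ← hY]
  linarith

/-- The subtracted profile has slow part a₁(1, -δ, δ-δ²)e₁, an approximate eigenvector: it leaves
residual 0 in the second equation and O(δ³) in the others. Bare diagonal modes would leave a
first-component residual of size δ², too large against the rate δ². -/
theorem sq_sum_le_of_weak_system {ρ δ M : ℝ} (hρ : 0 < ρ) (hδ : 0 < δ) (hδ1 : δ ≤ 1 / 4)
    {c₁ c₂ c₃ : ℝ → ℝ} (hc₁ : ContinuousOn c₁ (Ici 0)) (hc₂ : ContinuousOn c₂ (Ici 0))
    (hc₃ : ContinuousOn c₃ (Ici 0))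
    (hd₁ : ∀ t, 0 < t → HasDerivAt c₁ (-(ρ * δ * c₃ t)) t)
    (hd₂ : ∀ t, 0 < t → HasDerivAt c₂ (-(ρ * δ * (c₂ t + c₃ t))) t)
    (hd₃ : ∀ t, 0 < t → HasDerivAt c₃ (-(ρ * c₃ t) + ρ * δ * (c₁ t + c₂ t)) t)
    {a₁ a₂ a₃ : ℝ} (h₁ : |a₁| ≤ M) (h₂ : |a₂| ≤ M) (h₃ : |a₃| ≤ M)
    (i₁ : c₁ 0 = a₁) (i₂ : c₂ 0 = a₂) (i₃ : c₃ 0 = a₃) {t : ℝ} (ht : 0 ≤ t) :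
    (c₁ t - a₁ * Real.exp (-(ρ * δ ^ 2 * t))) ^ 2 +
      (c₂ t + δ * a₁ * Real.exp (-(ρ * δ ^ 2 * t)) - a₂ * Real.exp (-(ρ * δ * t))) ^ 2 +
      (c₃ t - (δ - δ ^ 2) * a₁ * Real.exp (-(ρ * δ ^ 2 * t)) - δ * a₂ * Real.exp (-(ρ * δ * t)) -
        a₃ * Real.exp (-(ρ * t))) ^ 2 ≤
      (19 * Real.exp 12 * (δ * M) * Real.exp (-(ρ * δ ^ 2 * t / 32))) ^ 2 := by
  have hδ2 : δ ^ 2 ≤ δ / 4 := by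
    have := mul_le_mul_of_nonneg_left hδ1 hδ.le
    linarith only [this]
  have hδ21 : δ ^ 2 ≤ 1 := by linarith only [hδ2, hδ1]
  set e₁ : ℝ → ℝ := fun t => Real.exp (-(ρ * δ ^ 2 * t)) with he₁
  set e₂ : ℝ → ℝ := fun t => Real.exp (-(ρ * δ * t)) with he₂
  set e₃ : ℝ → ℝ := fun t => Real.exp (-(ρ * t)) with he₃
  have de₁ : ∀ t, HasDerivAt e₁ (-(ρ * δ ^ 2 * e₁ t)) t := hasDerivAt_exp_neg_mul _
  have de₂ : ∀ t, HasDerivAt e₂ (-(ρ * δ * e₂ t)) t := hasDerivAt_exp_neg_mul _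
  have de₃ : ∀ t, HasDerivAt e₃ (-(ρ * e₃ t)) t := hasDerivAt_exp_neg_mul _
  have ce₁ : Continuous e₁ := by fun_prop
  have ce₂ : Continuous e₂ := by fun_prop
  have ce₃ : Continuous e₃ := by fun_prop
  set E₁ : ℝ → ℝ := fun t => c₁ t - a₁ * e₁ t with hE₁
  set E₂ : ℝ → ℝ := fun t => c₂ t + δ * a₁ * e₁ t - a₂ * e₂ t with hE₂
  set E₃ : ℝ → ℝ := fun t => c₃ t - (δ - δ ^ 2) * a₁ * e₁ t - δ * a₂ * e₂ t - a₃ * e₃ t with hE₃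
  change E₁ t ^ 2 + E₂ t ^ 2 + E₃ t ^ 2 ≤ _
  have cE₁ : ContinuousOn E₁ (Ici 0) := by fun_prop
  have cE₂ : ContinuousOn E₂ (Ici 0) := by fun_prop
  have cE₃ : ContinuousOn E₃ (Ici 0) := by fun_prop
  have dE₁ : ∀ t, 0 < t → HasDerivAt E₁ (ρ * (-(δ * E₃ t) +
      (δ ^ 3 * a₁ * e₁ t - δ ^ 2 * a₂ * e₂ t - δ * a₃ * e₃ t))) t := fun t ht =>
    ((hd₁ t ht).sub ((de₁ t).const_mul a₁)).congr_deriv (by simp only [hE₃]; ring)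
  have dE₂ : ∀ t, 0 < t → HasDerivAt E₂ (ρ * (-(δ * (E₂ t + E₃ t)) -
      (δ ^ 2 * a₂ * e₂ t + δ * a₃ * e₃ t))) t := fun t ht =>
    (((hd₂ t ht).add ((de₁ t).const_mul (δ * a₁))).sub ((de₂ t).const_mul a₂)).congr_deriv
      (by simp only [hE₂, hE₃]; ring)
  have dE₃ : ∀ t, 0 < t → HasDerivAt E₃ (ρ * (-E₃ t + δ * (E₁ t + E₂ t) +
        ((δ ^ 3 - δ ^ 4) * a₁ * e₁ t + δ ^ 2 * a₂ * e₂ t))) t := fun t ht =>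
    ((((hd₃ t ht).sub ((de₁ t).const_mul ((δ - δ ^ 2) * a₁))).sub
      ((de₂ t).const_mul (δ * a₂))).sub ((de₃ t).const_mul a₃)).congr_deriv
      (by simp only [hE₁, hE₂, hE₃]; ring)
  set Y : ℝ → ℝ := fun t => (E₁ t ^ 2 + E₂ t ^ 2 + E₃ t ^ 2) / 2 - δ / 4 * (E₁ t * E₃ t) with hY
  -- The terms 12e₂ + 12e₃ in g are minus the time integrals of the integrable rates 12ρδe₂ and
  -- 12ρe₃; they are at most 24, whence e^{24}. The sources in k' keep only half the rates of e₂ and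
  -- e₃, leaving room for the growth e^{ρδ²t/16} in the integrating factor.
  have hdec := exp_mul_sub_le_of_deriv_le (L := Y)
    (g := fun t => ρ * δ ^ 2 * t / 16 + 12 * e₂ t + 12 * e₃ t)
    (g' := fun t => ρ * (δ ^ 2 / 16 - 12 * δ * e₂ t - 12 * e₃ t))
    (k := fun t => -(16 * Real.exp 24 * M ^ 2 * δ ^ 2 * (Real.exp (-(ρ * δ ^ 2 * t)) +
      2 * Real.exp (-(ρ * δ / 2 * t)) + 2 * Real.exp (-(ρ / 2 * t)))))
    (k' := fun t => ρ * (16 * Real.exp 24 * M ^ 2) * (δ ^ 4 * Real.exp (-(ρ * δ ^ 2 * t)) +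
      δ ^ 3 * Real.exp (-(ρ * δ / 2 * t)) + δ ^ 2 * Real.exp (-(ρ / 2 * t))))
    (by fun_prop) (by fun_prop) (by fun_prop)
    (fun t ht => (((((dE₁ t ht).fun_pow 2).fun_add ((dE₂ t ht).fun_pow 2)).fun_add
      ((dE₃ t ht).fun_pow 2)).div_const 2).fun_sub
        (((dE₁ t ht).fun_mul (dE₃ t ht)).const_mul (δ / 4)))
    (fun t ht => by
      refine (((((hasDerivAt_id t).const_mul (ρ * δ ^ 2)).div_const 16).add
        ((de₂ t).const_mul 12)).add ((de₃ t).const_mul 12)).congr_deriv ?_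
      ring)
    (fun t ht => by
      refine ((((hasDerivAt_exp_neg_mul (ρ * δ ^ 2) t).fun_add
        ((hasDerivAt_exp_neg_mul (ρ * δ / 2) t).const_mul 2)).fun_add
        ((hasDerivAt_exp_neg_mul (ρ / 2) t).const_mul 2)).const_mul
          (16 * Real.exp 24 * M ^ 2 * δ ^ 2)).fun_neg.congr_deriv ?_
      ring)
    (fun t ht => by
      have hw := lyapunov_deriv_le_weak (e₁ := e₁ t) (E₁ := E₁ t) (E₂ := E₂ t) (E₃ := E₃ t)
        hδ hδ1 h₁ h₂ h₃ (Real.exp_pos _).le (Real.exp_pos _).le (e₂ := e₂ t) (e₃ := e₃ t)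
      have hx := mul_le_mul_of_nonneg_left hw hρ.le
      have he₂1 : e₂ t ≤ 1 := Real.exp_le_one_iff.2 (by
        have : 0 ≤ ρ * δ * t := by positivity
        linarith only [this])
      have he₃1 : e₃ t ≤ 1 := Real.exp_le_one_iff.2 (by
        have : 0 ≤ ρ * t := by positivity
        linarith only [this])
      set G := Real.exp (-(ρ * δ ^ 2 * t / 16 + 12 * e₂ t + 12 * e₃ t)) with hG
      have hp : 0 ≤ ρ * t := by positivity
      have p₁ : e₁ t ^ 2 ≤ Real.exp 24 * Real.exp (-(ρ * δ ^ 2 * t)) * G := by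
        rw [he₁, hG, ← Real.exp_add, ← Real.exp_add, ← Real.exp_nat_mul, Real.exp_le_exp]
        have : 0 ≤ ρ * δ ^ 2 * t := by positivity
        push_cast
        linarith only [this, he₂1, he₃1]
      have p₂ : e₂ t ≤ Real.exp 24 * Real.exp (-(ρ * δ / 2 * t)) * G := by
        rw [hG, ← Real.exp_add, ← Real.exp_add]
        refine Real.exp_le_exp.2 ?_
        have h1 : ρ * t * δ ^ 2 ≤ ρ * t * (δ / 4) := by gcongr
        have h2 : 0 ≤ ρ * t * δ := by positivity
        linarith only [h1, h2, he₂1, he₃1]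
      have p₃ : e₃ t ≤ Real.exp 24 * Real.exp (-(ρ / 2 * t)) * G := by
        rw [hG, ← Real.exp_add, ← Real.exp_add]
        refine Real.exp_le_exp.2 ?_
        have h1 : ρ * t * δ ^ 2 ≤ ρ * t * 1 := by gcongr
        linarith only [h1, hp, he₂1, he₃1]
      have hM : 0 ≤ ρ * (16 * M ^ 2) := by positivity
      have q : ρ * (16 * M ^ 2) * (δ ^ 4 * e₁ t ^ 2 + δ ^ 3 * e₂ t + δ ^ 2 * e₃ t) ≤
          ρ * (16 * M ^ 2) * (δ ^ 4 * (Real.exp 24 * Real.exp (-(ρ * δ ^ 2 * t)) * G) +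
            δ ^ 3 * (Real.exp 24 * Real.exp (-(ρ * δ / 2 * t)) * G) +
            δ ^ 2 * (Real.exp 24 * Real.exp (-(ρ / 2 * t)) * G)) := by gcongr
      simp only [hY]
      push_cast
      linarith only [hx, q]) ht
  have e₁0 : e₁ 0 = 1 := by simp [he₁]
  have e₂0 : e₂ 0 = 1 := by simp [he₂]
  have e₃0 : e₃ 0 = 1 := by simp [he₃]
  have hsq : ∀ a : ℝ, |a| ≤ M → a ^ 2 ≤ M ^ 2 := fun a ha => by
    rw [← sq_abs]; gcongr
  have s₁ := hsq _ h₁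
  have s₂ := hsq _ h₂
  have hδM : 0 ≤ δ ^ 2 * M ^ 2 := by positivity
  have hY0 : Y 0 ≤ 3 * (δ ^ 2 * M ^ 2) := by
    have x₁ : E₁ 0 = 0 := by simp [hE₁, e₁0, i₁]
    have x₂ : E₂ 0 = δ * a₁ := by simp [hE₂, e₁0, e₂0, i₂]
    have x₃ : E₃ 0 = -(δ * ((1 - δ) * a₁ + a₂)) := by simp [hE₃, e₁0, e₂0, e₃0, i₃]; ring
    simp only [hY, x₁, x₂, x₃]
    have y₁ : ((1 - δ) * a₁ + a₂) ^ 2 ≤ 2 * ((1 - δ) ^ 2 * a₁ ^ 2) + 2 * a₂ ^ 2 := by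
      linarith only [sq_nonneg ((1 - δ) * a₁ - a₂)]
    have y₂ : (1 - δ) ^ 2 * a₁ ^ 2 ≤ a₁ ^ 2 := mul_le_of_le_one_left (sq_nonneg _)
      (by linarith only [hδ2, hδ, hδ1])
    have y₃ : a₁ ^ 2 + ((1 - δ) * a₁ + a₂) ^ 2 ≤ 5 * M ^ 2 := by linarith only [y₁, y₂, s₁, s₂]
    have := mul_le_mul_of_nonneg_left y₃ (sq_nonneg δ)
    linarith only [this, hδM]
  simp only [e₂0, e₃0, mul_zero, zero_div, neg_zero, Real.exp_zero] at hdec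
  have hx24 := Real.exp_pos 24
  have hgt : Real.exp (ρ * δ ^ 2 * t / 16) ≤
      Real.exp (ρ * δ ^ 2 * t / 16 + 12 * e₂ t + 12 * e₃ t) := by
    apply Real.exp_le_exp.2
    have := Real.exp_pos (-(ρ * δ * t))
    have := Real.exp_pos (-(ρ * t))
    simp only [he₂, he₃]
    linarith only [‹0 < Real.exp (-(ρ * δ * t))›, ‹0 < Real.exp (-(ρ * t))›]
  have hYS : E₁ t ^ 2 + E₂ t ^ 2 + E₃ t ^ 2 ≤ 4 * Y t := by
    simp only [hY]
    linarith only [mul_nonneg hδ.le (sq_nonneg (E₁ t - E₃ t)), mul_nonneg (sub_nonneg.2 hδ1)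
      (add_nonneg (sq_nonneg (E₁ t)) (sq_nonneg (E₃ t))), sq_nonneg (E₁ t), sq_nonneg (E₂ t),
      sq_nonneg (E₃ t)]
  have hYt0 : 0 ≤ Y t := by
    have : 0 ≤ E₁ t ^ 2 + E₂ t ^ 2 + E₃ t ^ 2 := by positivity
    linarith only [this, hYS]
  -- 83 = 3 + 16·(1 + 2 + 2): the initial energy plus the total source. Later 4·83 ≤ 19².
  have hmain : Real.exp (ρ * δ ^ 2 * t / 16) * Y t ≤ 83 * Real.exp 24 * (δ ^ 2 * M ^ 2) := by
    have h1 : Real.exp (ρ * δ ^ 2 * t / 16) * Y t ≤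
      Real.exp (ρ * δ ^ 2 * t / 16 + 12 * e₂ t + 12 * e₃ t) * Y t := by gcongr
    have h2 := mul_le_mul_of_nonneg_left hY0 hx24.le
    rw [show (0 : ℝ) + 12 * 1 + 12 * 1 = 24 by norm_num] at hdec
    have h3 : 0 ≤ 16 * Real.exp 24 * M ^ 2 * δ ^ 2 * (Real.exp (-(ρ * δ ^ 2 * t)) +
      2 * Real.exp (-(ρ * δ / 2 * t)) + 2 * Real.exp (-(ρ / 2 * t))) := by positivity
    generalize Real.exp (ρ * δ ^ 2 * t / 16 + 12 * e₂ t + 12 * e₃ t) = A at *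
    generalize Real.exp 24 = B at *
    linarith only [h1, h2, h3, hdec]
  have hfin : Y t ≤ 83 * Real.exp 24 * (δ ^ 2 * M ^ 2) * Real.exp (-(ρ * δ ^ 2 * t / 16)) := by
    have := mul_le_mul_of_nonneg_right hmain (Real.exp_pos (-(ρ * δ ^ 2 * t / 16))).le
    rwa [mul_right_comm, ← Real.exp_add, add_neg_cancel, Real.exp_zero, one_mul] at this
  have r₁ : Real.exp 12 ^ 2 = Real.exp 24 := by rw [← Real.exp_nat_mul]; norm_num
  have r₂ : Real.exp (-(ρ * δ ^ 2 * t / 32)) ^ 2 = Real.exp (-(ρ * δ ^ 2 * t / 16)) := by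
    rw [← Real.exp_nat_mul]; congr 1; push_cast; ring
  rw [mul_pow, mul_pow, mul_pow, r₁, r₂, mul_pow]
  have : 0 ≤ Real.exp 24 * (δ ^ 2 * M ^ 2) * Real.exp (-(ρ * δ ^ 2 * t / 16)) := by positivity
  linarith only [hYS, hfin, this]

/-- A solution of `T₁ T_{1½} b = a` is bounded by the data `a`. -/
theorem weak_modes_le {δ M a₁ a₂ a₃ b₁ b₂ b₃ : ℝ} (hδ : 0 < δ) (hδ1 : δ ≤ 1 / 4)
    (h₁ : |a₁| ≤ M) (h₂ : |a₂| ≤ M) (h₃ : |a₃| ≤ M)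
    (i₁ : b₁ + δ * b₃ + δ ^ 3 * b₂ = a₁) (i₂ : b₂ + (δ + δ ^ 2) * b₃ + δ ^ 3 * b₂ = a₂)
    (i₃ : b₃ + δ * b₁ + (δ + δ ^ 2) * b₂ + δ ^ 3 * b₃ = a₃) :
    |b₁| ≤ 3 * M ∧ |b₂| ≤ 3 * M ∧ |b₃| ≤ 3 * M := by
  have hδ2 : δ ^ 2 ≤ 1 / 16 := by nlinarith only [hδ, hδ1]
  have hδ3 : δ ^ 3 ≤ 1 / 64 := by nlinarith only [hδ, hδ1, hδ2]
  have hδ3' : 0 ≤ δ ^ 3 := by positivity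
  set m := max |b₁| (max |b₂| |b₃|) with hmd
  have m₁ : |b₁| ≤ m := le_max_left _ _
  have m₂ : |b₂| ≤ m := (le_max_left _ _).trans (le_max_right _ _)
  have m₃ : |b₃| ≤ m := (le_max_right _ _).trans (le_max_right _ _)
  have m0 : 0 ≤ m := (abs_nonneg _).trans m₁
  have term : ∀ k x : ℝ, 0 ≤ k → |x| ≤ m → |k * x| ≤ k * m := fun k x hk hx => by
    rw [abs_mul, abs_of_nonneg hk]; gcongr
  have dm : δ * m ≤ 1 / 4 * m := by gcongr
  have d2m : δ ^ 2 * m ≤ 1 / 16 * m := by gcongr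
  have d3m : δ ^ 3 * m ≤ 1 / 64 * m := by gcongr
  have x₁ : |b₁| ≤ M + 2 / 3 * m := by
    have e : b₁ = a₁ - δ * b₃ - δ ^ 3 * b₂ := by linarith
    have t1 := term δ _ hδ.le m₃
    have t2 := term _ _ hδ3' m₂
    rw [e]
    refine (abs_sub _ _).trans ?_
    linarith [abs_sub (a₁) (δ * b₃)]
  have x₂ : |b₂| ≤ M + 2 / 3 * m := by
    have e : b₂ = a₂ - (δ + δ ^ 2) * b₃ - δ ^ 3 * b₂ := by linarith
    have t1 := term (δ + δ ^ 2) _ (by positivity) m₃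
    have t2 := term _ _ hδ3' m₂
    rw [e]
    refine (abs_sub _ _).trans ?_
    linarith [abs_sub (a₂) ((δ + δ ^ 2) * b₃)]
  have x₃ : |b₃| ≤ M + 2 / 3 * m := by
    have e : b₃ = a₃ - δ * b₁ - (δ + δ ^ 2) * b₂ - δ ^ 3 * b₃ := by linarith
    have t1 := term (δ + δ ^ 2) _ (by positivity) m₂
    have t2 := term _ _ hδ3' m₃
    have t3 := term _ _ hδ.le m₁
    rw [e]
    refine (abs_sub _ _).trans ?_
    linarith [abs_sub (a₃ - δ * b₁) ((δ + δ ^ 2) * b₂), abs_sub (a₃) (δ * b₁)]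
  -- T₁T_{1½} is the identity plus a matrix of row sums at most 2/3, so the perturbation is absorbed
  -- in the maximum norm.
  have : m ≤ M + 2 / 3 * m := max_le x₁ (max_le x₂ x₃)
  have hm : m ≤ 3 * M := by linarith only [this]
  exact ⟨m₁.trans hm, m₂.trans hm, m₃.trans hm⟩

/-- The diagonal modes are parametrised by v(0) and the energy profile by c(0); rewriting c(0)
through v(0) makes all leading terms cancel, and every remaining term has a coefficient O(δ). -/
theorem abs_sub_le_of_weak_system {ρ δ M : ℝ} (hρ : 0 < ρ) (hδ : 0 < δ) (hδ1 : δ ≤ 1 / 4)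
    {c₁ c₂ c₃ : ℝ → ℝ} (hc₁ : ContinuousOn c₁ (Ici 0)) (hc₂ : ContinuousOn c₂ (Ici 0))
    (hc₃ : ContinuousOn c₃ (Ici 0))
    (hd₁ : ∀ t, 0 < t → HasDerivAt c₁ (-(ρ * δ * c₃ t)) t)
    (hd₂ : ∀ t, 0 < t → HasDerivAt c₂ (-(ρ * δ * (c₂ t + c₃ t))) t)
    (hd₃ : ∀ t, 0 < t → HasDerivAt c₃ (-(ρ * c₃ t) + ρ * δ * (c₁ t + c₂ t)) t)
    (h₁ : |c₁ 0| ≤ M) (h₂ : |c₂ 0| ≤ M) (h₃ : |c₃ 0| ≤ M) {v₁ v₂ v₃ : ℝ → ℝ}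
    (hv₁ : ∀ t, 0 ≤ t → v₁ t = Real.exp (-(ρ * δ ^ 2 * t)) * v₁ 0)
    (hv₂ : ∀ t, 0 ≤ t → v₂ t = Real.exp (-(ρ * δ * t)) * v₂ 0)
    (hv₃ : ∀ t, 0 ≤ t → v₃ t = Real.exp (-(ρ * t)) * v₃ 0)
    (i₁ : v₁ 0 + δ * v₃ 0 + δ ^ 3 * v₂ 0 = c₁ 0)
    (i₂ : v₂ 0 + (δ + δ ^ 2) * v₃ 0 + δ ^ 3 * v₂ 0 = c₂ 0)
    (i₃ : v₃ 0 + δ * v₁ 0 + (δ + δ ^ 2) * v₂ 0 + δ ^ 3 * v₃ 0 = c₃ 0)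
    {t : ℝ} (ht : 0 ≤ t) :
    |c₁ t - (v₁ t + δ * v₃ t + δ ^ 3 * v₂ t)| ≤
      40 * Real.exp 12 * (δ * M) * Real.exp (-(ρ * δ ^ 2 * t / 32)) ∧
    |c₂ t - (v₂ t + (δ + δ ^ 2) * v₃ t + δ ^ 3 * v₂ t)| ≤
      40 * Real.exp 12 * (δ * M) * Real.exp (-(ρ * δ ^ 2 * t / 32)) ∧
    |c₃ t - (v₃ t + δ * v₁ t + (δ + δ ^ 2) * v₂ t + δ ^ 3 * v₃ t)| ≤
      40 * Real.exp 12 * (δ * M) * Real.exp (-(ρ * δ ^ 2 * t / 32)) := by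
  have hsq := sq_sum_le_of_weak_system hρ hδ hδ1 hc₁ hc₂ hc₃ hd₁ hd₂ hd₃ h₁ h₂ h₃ rfl rfl rfl ht
  rw [hv₁ t ht, hv₂ t ht, hv₃ t ht]
  have hM : 0 ≤ M := (abs_nonneg _).trans h₁
  have hδ2 : δ ^ 2 ≤ δ / 4 := by nlinarith only [hδ, hδ1]
  have hδ2' : 0 ≤ δ ^ 2 := by positivity
  have hδ3 : δ ^ 3 ≤ δ / 16 := by nlinarith only [hδ, hδ1, hδ2]
  have hδ3' : 0 ≤ δ ^ 3 := by positivity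
  obtain ⟨n₁, n₂, n₃⟩ := weak_modes_le hδ hδ1 h₁ h₂ h₃ i₁ i₂ i₃
  set e₁ := Real.exp (-(ρ * δ ^ 2 * t)) with he₁
  set e₂ := Real.exp (-(ρ * δ * t)) with he₂
  set e₃ := Real.exp (-(ρ * t)) with he₃
  set e := Real.exp (-(ρ * δ ^ 2 * t / 32)) with he
  have hρt : 0 ≤ ρ * t := by positivity
  have le₁ : e₁ ≤ e := Real.exp_le_exp.2 (by
    have : 0 ≤ ρ * t * δ ^ 2 := by positivity
    linarith)
  have le₂ : e₂ ≤ e := Real.exp_le_exp.2 (by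
    have h1 : ρ * t * δ ^ 2 ≤ ρ * t * (δ / 4) := by gcongr
    have : 0 ≤ ρ * t * δ := by positivity
    linarith)
  have le₃ : e₃ ≤ e := Real.exp_le_exp.2 (by
    have h1 : ρ * t * δ ^ 2 ≤ ρ * t * 1 := by gcongr; linarith only [hδ2, hδ1]
    linarith only [h1, hρt])
  have p₁ : 0 ≤ e₁ := (Real.exp_pos _).le
  have p₂ : 0 ≤ e₂ := (Real.exp_pos _).le
  have p₃ : 0 ≤ e₃ := (Real.exp_pos _).le
  have p : 0 ≤ e := (Real.exp_pos _).le
  have hX0 : 0 ≤ 19 * Real.exp 12 * (δ * M) * e := by positivity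
  have hx12 : 1 ≤ Real.exp 12 := Real.one_le_exp (by norm_num)
  have hδMe : 0 ≤ δ * M * e := by positivity
  have hde : δ * M * e ≤ Real.exp 12 * (δ * M) * e := by
    linarith only [mul_le_mul_of_nonneg_right hx12 hδMe]
  have B : ∀ k x b s : ℝ, |k| ≤ s * δ → 0 ≤ x → x ≤ e → |b| ≤ 3 * M →
      |k * (x * b)| ≤ s * 3 * (δ * M * e) := by
    intro k x b s hk hx hxe hb
    rw [abs_mul, abs_mul, abs_of_nonneg hx]
    calc |k| * (x * |b|) ≤ (s * δ) * (e * (3 * M)) := by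
          gcongr
          exact (abs_nonneg _).trans hk
      _ = _ := by ring
  have o₁ : |c₁ 0| ≤ 3 * M := by linarith
  have o₂ : |c₂ 0| ≤ 3 * M := by linarith
  have o₃ : |c₃ 0| ≤ 3 * M := by linarith
  have kd : |δ| ≤ 1 * δ := by rw [abs_of_pos hδ, one_mul]
  have kd3 : |δ ^ 3| ≤ 1 / 16 * δ := by rw [abs_of_nonneg hδ3']; linarith
  have kd12 : |δ + δ ^ 2| ≤ 5 / 4 * δ := by rw [abs_of_nonneg (by positivity)]; linarith
  have kd12' : |δ - δ ^ 2| ≤ 1 * δ := by rw [abs_of_nonneg (by linarith)]; linarith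
  refine ⟨?_, ?_, ?_⟩
  · have h := abs_le_of_sq_le_sq (a := c₁ t - c₁ 0 * e₁) ((le_add_of_nonneg_right (sq_nonneg _)).trans
      ((le_add_of_nonneg_right (sq_nonneg _)).trans hsq)) hX0
    have q₁ := abs_le.1 (B δ e₁ (v₃ 0) 1 kd p₁ le₁ n₃)
    have q₂ := abs_le.1 (B (δ ^ 3) e₁ (v₂ 0) _ kd3 p₁ le₁ n₂)
    have q₃ := abs_le.1 (B δ e₃ (v₃ 0) 1 kd p₃ le₃ n₃)
    have q₄ := abs_le.1 (B (δ ^ 3) e₂ (v₂ 0) _ kd3 p₂ le₂ n₂)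
    have := abs_le.1 h
    rw [← i₁] at this
    rw [abs_le]
    constructor <;> linarith only [this.1, this.2, hde, hδMe, q₁.1, q₁.2, q₂.1, q₂.2, q₃.1, q₃.2, q₄.1, q₄.2]
  · have h := abs_le_of_sq_le_sq (a := c₂ t + δ * c₁ 0 * e₁ - c₂ 0 * e₂) ((le_add_of_nonneg_left (sq_nonneg _)).trans
      ((le_add_of_nonneg_right (sq_nonneg _)).trans hsq)) hX0
    have q₁ := abs_le.1 (B δ e₁ (c₁ 0) 1 kd p₁ le₁ o₁)
    have q₂ := abs_le.1 (B (δ + δ ^ 2) e₂ (v₃ 0) _ kd12 p₂ le₂ n₃)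
    have q₃ := abs_le.1 (B (δ + δ ^ 2) e₃ (v₃ 0) _ kd12 p₃ le₃ n₃)
    have := abs_le.1 h
    rw [← i₂] at this
    rw [abs_le]
    constructor <;> linarith only [this.1, this.2, hde, hδMe, q₁.1, q₁.2, q₂.1, q₂.2, q₃.1, q₃.2]
  · have h := abs_le_of_sq_le_sq (a := c₃ t - (δ - δ ^ 2) * c₁ 0 * e₁ - δ * c₂ 0 * e₂ - c₃ 0 * e₃)
      ((le_add_of_nonneg_left (by positivity)).trans hsq) hX0
    have q₁ := abs_le.1 (B (δ - δ ^ 2) e₁ (c₁ 0) 1 kd12' p₁ le₁ o₁)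
    have q₂ := abs_le.1 (B δ e₂ (c₂ 0) 1 kd p₂ le₂ o₂)
    have q₃ := abs_le.1 (B δ e₃ (v₁ 0) 1 kd p₃ le₃ n₁)
    have q₄ := abs_le.1 (B δ e₁ (v₁ 0) 1 kd p₁ le₁ n₁)
    have q₅ := abs_le.1 (B (δ + δ ^ 2) e₃ (v₂ 0) _ kd12 p₃ le₃ n₂)
    have q₆ := abs_le.1 (B (δ + δ ^ 2) e₂ (v₂ 0) _ kd12 p₂ le₂ n₂)
    have := abs_le.1 h
    rw [← i₃] at this
    rw [abs_le]
    constructor <;> linarith only [this.1, this.2, hde, hδMe, q₁.1, q₁.2, q₂.1, q₂.2, q₃.1,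
      q₃.2, q₄.1, q₄.2, q₅.1, q₅.2, q₆.1, q₆.2]

/-! ### Energy estimate for strong damping. -/

/-- Only E₂ is damped when δ = 0. The cross term E₂E₃/4 passes this damping to E₃, and -E₁E₃/8
passes it on to E₁. With δ = f = 0 this is the reference system; with f = z₃ it is the system for
the difference. -/
theorem lyapunov_deriv_le_strong {δ f E₁ E₂ E₃ : ℝ} (hδ : 0 ≤ δ) (hδ1 : δ ≤ 1 / 4) :
    (E₁ - E₃ / 8) * (-E₃) + (E₂ + E₃ / 4) * (-(E₂ + E₃)) +
      (E₃ + E₂ / 4 - E₁ / 8) * (E₁ + E₂ - δ * E₃ - δ * f) ≤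
    -(1 / 32) * ((E₁ ^ 2 + E₂ ^ 2 + E₃ ^ 2) / 2 + E₂ * E₃ / 4 - E₁ * E₃ / 8) +
      32 * δ ^ 2 * f ^ 2 := by
  have h1 : (E₃ + E₂ / 4 - E₁ / 8) * (-(δ * f)) ≤
      (E₃ + E₂ / 4 - E₁ / 8) ^ 2 / 128 + 32 * δ ^ 2 * f ^ 2 := by
    linarith only [sq_nonneg ((E₃ + E₂ / 4 - E₁ / 8) + 64 * (δ * f))]
  have h2 : (E₃ + E₂ / 4 - E₁ / 8) ^ 2 ≤ 2 * (E₁ ^ 2 + E₂ ^ 2 + E₃ ^ 2) := by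
    linarith only [sq_nonneg (E₃ - 4 * E₂), sq_nonneg (E₃ + 8 * E₁), sq_nonneg (E₂ + 2 * E₁),
      sq_nonneg E₁, sq_nonneg E₂, sq_nonneg E₃, sq_nonneg (E₃ - E₂), sq_nonneg (E₃ + E₁),
      sq_nonneg (E₂ + E₁)]
  have h3 : -(E₂ * E₃) * (1 + δ) ≤ E₃ ^ 2 / 4 + 25 / 16 * E₂ ^ 2 := by
    have a1 : (1 + δ) ^ 2 ≤ 25 / 16 := by nlinarith only [hδ, hδ1]
    have a2 := mul_le_mul_of_nonneg_right a1 (sq_nonneg E₂)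
    linarith only [sq_nonneg (E₃ / 2 + (1 + δ) * E₂), a2]
  have h4 : δ * (E₁ * E₃) ≤ (E₁ ^ 2 + E₃ ^ 2) / 8 := by
    have a1 := mul_le_mul_of_nonneg_right hδ1 (add_nonneg (sq_nonneg E₁) (sq_nonneg E₃))
    linarith only [a1, mul_nonneg hδ (sq_nonneg (E₁ - E₃))]
  have h5 : E₁ * E₂ ≤ E₁ ^ 2 / 4 + E₂ ^ 2 := by linarith only [sq_nonneg (E₁ / 2 - E₂)]
  have h6 := mul_nonneg hδ (sq_nonneg E₃)
  have h7 : (E₁ ^ 2 + E₂ ^ 2 + E₃ ^ 2) / 2 + E₂ * E₃ / 4 - E₁ * E₃ / 8 ≤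
      E₁ ^ 2 + E₂ ^ 2 + E₃ ^ 2 := by
    linarith only [sq_nonneg (E₂ - E₃), sq_nonneg (E₁ + E₃), sq_nonneg E₁, sq_nonneg E₂,
      sq_nonneg E₃]
  linarith only [h1, h2, h3, h4, h5, h6, h7, sq_nonneg E₁, sq_nonneg E₂, sq_nonneg E₃]

theorem sq_sum_le_strong_energy (E₁ E₂ E₃ : ℝ) :
    E₁ ^ 2 + E₂ ^ 2 + E₃ ^ 2 ≤
      4 * ((E₁ ^ 2 + E₂ ^ 2 + E₃ ^ 2) / 2 + E₂ * E₃ / 4 - E₁ * E₃ / 8) := by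
  linarith only [sq_nonneg (E₂ + E₃), sq_nonneg (E₁ - E₃), sq_nonneg E₁, sq_nonneg E₂, sq_nonneg E₃]

theorem hasDerivAt_strong_energy {E₁ E₂ E₃ : ℝ → ℝ} {d₁ d₂ d₃ t : ℝ} (h₁ : HasDerivAt E₁ d₁ t)
    (h₂ : HasDerivAt E₂ d₂ t) (h₃ : HasDerivAt E₃ d₃ t) :
    HasDerivAt (fun t => (E₁ t ^ 2 + E₂ t ^ 2 + E₃ t ^ 2) / 2 + E₂ t * E₃ t / 4 - E₁ t * E₃ t / 8)
      ((E₁ t - E₃ t / 8) * d₁ + (E₂ t + E₃ t / 4) * d₂ + (E₃ t + E₂ t / 4 - E₁ t / 8) * d₃) t := by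
  refine ((((((h₁.fun_pow 2).fun_add (h₂.fun_pow 2)).fun_add (h₃.fun_pow 2)).div_const 2).fun_add
    ((h₂.fun_mul h₃).div_const 4)).fun_sub ((h₁.fun_mul h₃).div_const 8)).congr_deriv ?_
  push_cast
  ring

theorem sq_le_of_strong_system {β M : ℝ} (hβ : 0 < β)
    {z₁ z₂ z₃ : ℝ → ℝ} (hz₁ : ContinuousOn z₁ (Ici 0)) (hz₂ : ContinuousOn z₂ (Ici 0))
    (hz₃ : ContinuousOn z₃ (Ici 0))
    (hd₁ : ∀ t, 0 < t → HasDerivAt z₁ (-(β * z₃ t)) t)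
    (hd₂ : ∀ t, 0 < t → HasDerivAt z₂ (-(β * (z₂ t + z₃ t))) t)
    (hd₃ : ∀ t, 0 < t → HasDerivAt z₃ (β * (z₁ t + z₂ t)) t)
    (h₁ : |z₁ 0| ≤ M) (h₂ : |z₂ 0| ≤ M) (h₃ : |z₃ 0| ≤ M) {t : ℝ} (ht : 0 ≤ t) :
    z₃ t ^ 2 ≤ 12 * M ^ 2 * Real.exp (-(β / 32 * t)) := by
  have hdec := exp_mul_sub_le_of_deriv_le
    (L := fun t => (z₁ t ^ 2 + z₂ t ^ 2 + z₃ t ^ 2) / 2 + z₂ t * z₃ t / 4 - z₁ t * z₃ t / 8)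
    (g := fun t => β / 32 * t) (g' := fun _ => β / 32) (k := fun _ => 0) (k' := fun _ => 0)
    (by fun_prop) (by fun_prop) (by fun_prop)
    (fun t ht => hasDerivAt_strong_energy (hd₁ t ht) (hd₂ t ht) (hd₃ t ht))
    (fun t _ => by simpa using (hasDerivAt_id t).const_mul (β / 32))
    (fun t _ => hasDerivAt_const _ _)
    (fun t ht => by
      have := mul_le_mul_of_nonneg_left (lyapunov_deriv_le_strong (δ := 0) (f := 0) (E₁ := z₁ t)
        (E₂ := z₂ t) (E₃ := z₃ t) le_rfl (by norm_num)) hβ.le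
      linarith only [this]) ht
  simp only [mul_zero, Real.exp_zero, sub_zero, one_mul] at hdec
  have hsq : ∀ a : ℝ, |a| ≤ M → a ^ 2 ≤ M ^ 2 := fun a ha => by
    rw [← sq_abs]; gcongr
  have s₁ := hsq _ h₁
  have s₂ := hsq _ h₂
  have s₃ := hsq _ h₃
  have hY0 : (z₁ 0 ^ 2 + z₂ 0 ^ 2 + z₃ 0 ^ 2) / 2 + z₂ 0 * z₃ 0 / 4 - z₁ 0 * z₃ 0 / 8 ≤
      3 * M ^ 2 := by
    linarith only [s₁, s₂, s₃, sq_nonneg (z₂ 0 - z₃ 0), sq_nonneg (z₁ 0 + z₃ 0), sq_nonneg (z₁ 0)]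
  have hx := mul_le_mul_of_nonneg_right (hdec.trans hY0) (Real.exp_pos (-(β / 32 * t))).le
  rw [mul_right_comm, ← Real.exp_add, add_neg_cancel, Real.exp_zero, one_mul] at hx
  linarith only [hx, sq_sum_le_strong_energy (z₁ t) (z₂ t) (z₃ t), sq_nonneg (z₁ t),
    sq_nonneg (z₂ t)]

theorem abs_sub_le_of_strong_system {β δ M : ℝ} (hβ : 0 < β) (hδ : 0 ≤ δ) (hδ1 : δ ≤ 1 / 4)
    {c₁ c₂ c₃ : ℝ → ℝ} (hc₁ : ContinuousOn c₁ (Ici 0)) (hc₂ : ContinuousOn c₂ (Ici 0))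
    (hc₃ : ContinuousOn c₃ (Ici 0))
    (dc₁ : ∀ t, 0 < t → HasDerivAt c₁ (-(β * c₃ t)) t)
    (dc₂ : ∀ t, 0 < t → HasDerivAt c₂ (-(β * (c₂ t + c₃ t))) t)
    (dc₃ : ∀ t, 0 < t → HasDerivAt c₃ (β * (c₁ t + c₂ t) - β * δ * c₃ t) t)
    {z₁ z₂ z₃ : ℝ → ℝ} (hz₁ : ContinuousOn z₁ (Ici 0)) (hz₂ : ContinuousOn z₂ (Ici 0))
    (hz₃ : ContinuousOn z₃ (Ici 0))
    (hd₁ : ∀ t, 0 < t → HasDerivAt z₁ (-(β * z₃ t)) t)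
    (hd₂ : ∀ t, 0 < t → HasDerivAt z₂ (-(β * (z₂ t + z₃ t))) t)
    (hd₃ : ∀ t, 0 < t → HasDerivAt z₃ (β * (z₁ t + z₂ t)) t)
    (h₁ : |z₁ 0| ≤ M) (h₂ : |z₂ 0| ≤ M) (h₃ : |z₃ 0| ≤ M)
    (i₁ : c₁ 0 = z₁ 0) (i₂ : c₂ 0 = z₂ 0) (i₃ : c₃ 0 = z₃ 0) {t : ℝ} (ht : 0 ≤ t) :
    |c₁ t - z₁ t| ≤ 314 * (δ * M) * Real.exp (-(β * t / 128)) ∧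
    |c₂ t - z₂ t| ≤ 314 * (δ * M) * Real.exp (-(β * t / 128)) ∧
    |c₃ t - z₃ t| ≤ 314 * (δ * M) * Real.exp (-(β * t / 128)) := by
  have hM : 0 ≤ M := (abs_nonneg _).trans h₁
  obtain ⟨E₁, hE₁⟩ : ∃ E : ℝ → ℝ, E = fun t => c₁ t - z₁ t := ⟨_, rfl⟩
  obtain ⟨E₂, hE₂⟩ : ∃ E : ℝ → ℝ, E = fun t => c₂ t - z₂ t := ⟨_, rfl⟩
  obtain ⟨E₃, hE₃⟩ : ∃ E : ℝ → ℝ, E = fun t => c₃ t - z₃ t := ⟨_, rfl⟩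
  have k₁ : c₁ t - z₁ t = E₁ t := by rw [hE₁]
  have k₂ : c₂ t - z₂ t = E₂ t := by rw [hE₂]
  have k₃ : c₃ t - z₃ t = E₃ t := by rw [hE₃]
  have cE₁ : ContinuousOn E₁ (Ici 0) := by rw [hE₁]; fun_prop
  have cE₂ : ContinuousOn E₂ (Ici 0) := by rw [hE₂]; fun_prop
  have cE₃ : ContinuousOn E₃ (Ici 0) := by rw [hE₃]; fun_prop
  have dE₁ : ∀ t, 0 < t → HasDerivAt E₁ (-(β * E₃ t)) t := fun t ht => by
    rw [hE₁, hE₃]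
    exact ((dc₁ t ht).fun_sub (hd₁ t ht)).congr_deriv (by ring)
  have dE₂ : ∀ t, 0 < t → HasDerivAt E₂ (-(β * (E₂ t + E₃ t))) t := fun t ht => by
    rw [hE₂, hE₃]
    exact ((dc₂ t ht).fun_sub (hd₂ t ht)).congr_deriv (by ring)
  have dE₃ : ∀ t, 0 < t → HasDerivAt E₃ (β * (E₁ t + E₂ t - δ * E₃ t - δ * z₃ t)) t :=
    fun t ht => by
    rw [hE₁, hE₂, hE₃]
    exact ((dc₃ t ht).fun_sub (hd₃ t ht)).congr_deriv (by ring)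
  have x₁ : E₁ 0 = 0 := by simp [hE₁, i₁]
  have x₂ : E₂ 0 = 0 := by simp [hE₂, i₂]
  have x₃ : E₃ 0 = 0 := by simp [hE₃, i₃]
  rw [k₁, k₂, k₃]
  clear k₁ k₂ k₃ hE₁ hE₂ hE₃
  -- The rate is halved to β/64, so that the source, decaying like e^{-βt/32}, stays integrable
  -- after weighting. Here 384 = 32·12 and 24576 = 64·384; taking the square root of 4·24576 gives
  -- 314.
  have hdec := exp_mul_sub_le_of_deriv_le
    (L := fun t => (E₁ t ^ 2 + E₂ t ^ 2 + E₃ t ^ 2) / 2 + E₂ t * E₃ t / 4 - E₁ t * E₃ t / 8)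
    (g := fun t => β / 64 * t) (g' := fun _ => β / 64)
    (k := fun t => -(24576 * (δ * M) ^ 2 * Real.exp (-(β / 64 * t))))
    (k' := fun t => 384 * β * (δ * M) ^ 2 * Real.exp (-(β / 64 * t)))
    (by fun_prop) (by fun_prop) (by fun_prop)
    (fun t ht => hasDerivAt_strong_energy (dE₁ t ht) (dE₂ t ht) (dE₃ t ht))
    (fun t _ => by simpa using (hasDerivAt_id t).const_mul (β / 64))
    (fun t _ => ((hasDerivAt_exp_neg_mul (β / 64) t).const_mul
      (24576 * (δ * M) ^ 2)).fun_neg.congr_deriv (by ring))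
    (fun t ht => by
      have hl := mul_le_mul_of_nonneg_left (lyapunov_deriv_le_strong (f := z₃ t) (E₁ := E₁ t)
        (E₂ := E₂ t) (E₃ := E₃ t) hδ hδ1) hβ.le
      have hz := sq_le_of_strong_system hβ hz₁ hz₂ hz₃ hd₁ hd₂ hd₃ h₁ h₂ h₃ ht.le
      have hz' := mul_le_mul_of_nonneg_left hz (show 0 ≤ β * (32 * δ ^ 2) by positivity)
      have he : Real.exp (-(β / 64 * t)) * Real.exp (-(β / 64 * t)) = Real.exp (-(β / 32 * t)) := by
        rw [← Real.exp_add]; congr 1; ring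
      have hS := sq_sum_le_strong_energy (E₁ t) (E₂ t) (E₃ t)
      have hS' : 0 ≤ β * ((E₁ t ^ 2 + E₂ t ^ 2 + E₃ t ^ 2) / 2 + E₂ t * E₃ t / 4 -
          E₁ t * E₃ t / 8) := by
        apply mul_nonneg hβ.le
        linarith only [hS, sq_nonneg (E₁ t), sq_nonneg (E₂ t), sq_nonneg (E₃ t)]
      rw [mul_assoc _ (Real.exp _) (Real.exp _), he]
      linarith only [hl, hz', hS']) ht
  simp only [x₁, x₂, x₃, mul_zero, neg_zero, Real.exp_zero] at hdec
  have hS := sq_sum_le_strong_energy (E₁ t) (E₂ t) (E₃ t)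
  have hpos := Real.exp_pos (β / 64 * t)
  have hneg : 0 ≤ 24576 * (δ * M) ^ 2 * Real.exp (-(β / 64 * t)) := by positivity
  have hb : Real.exp (β / 64 * t) * (E₁ t ^ 2 + E₂ t ^ 2 + E₃ t ^ 2) ≤ 98304 * (δ * M) ^ 2 := by
    have := mul_le_mul_of_nonneg_left hS hpos.le
    norm_num at hdec
    linarith only [this, hdec, hneg]
  have hx := mul_le_mul_of_nonneg_right hb (Real.exp_pos (-(β / 64 * t))).le
  rw [mul_right_comm, ← Real.exp_add, add_neg_cancel, Real.exp_zero, one_mul] at hx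
  have hsq : E₁ t ^ 2 + E₂ t ^ 2 + E₃ t ^ 2 ≤ (314 * (δ * M) * Real.exp (-(β * t / 128))) ^ 2 := by
    have r₂ : Real.exp (-(β * t / 128)) ^ 2 = Real.exp (-(β / 64 * t)) := by
      rw [← Real.exp_nat_mul]; congr 1; push_cast; ring
    rw [mul_pow, r₂, mul_pow]
    have : 0 ≤ (δ * M) ^ 2 * Real.exp (-(β / 64 * t)) := by positivity
    linarith only [hx, this]
  have hX0 : 0 ≤ 314 * (δ * M) * Real.exp (-(β * t / 128)) := by positivity
  refine ⟨abs_le_of_sq_le_sq ?_ hX0, abs_le_of_sq_le_sq ?_ hX0, abs_le_of_sq_le_sq ?_ hX0⟩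
  · linarith only [hsq, sq_nonneg (E₂ t), sq_nonneg (E₃ t)]
  · linarith only [hsq, sq_nonneg (E₁ t), sq_nonneg (E₃ t)]
  · linarith only [hsq, sq_nonneg (E₁ t), sq_nonneg (E₂ t)]

/-! ### Matrix actions and reduction to the real systems. -/

theorem symbolA_mulVec (σ r : ℝ) (x : Fin 3 → ℂ) :
    symbolA σ r *ᵥ x =
      ![((r ^ 2 : ℝ) : ℂ) * (-(x 1 + x 2)) + ((r ^ (2 * σ) : ℝ) : ℂ) * ((1 / 2 : ℝ) * (x 0 + x 1)),
        ((r ^ 2 : ℝ) : ℂ) * (x 0 - x 2) + ((r ^ (2 * σ) : ℝ) : ℂ) * ((1 / 2 : ℝ) * (x 0 + x 1)),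
        ((r ^ 2 : ℝ) : ℂ) * ((1 / 2 : ℝ) * (x 0 + x 1) + x 2)] := by
  ext i
  fin_cases i <;>
  · simp [symbolA, A0, A1, Matrix.mulVec, dotProduct, Fin.sum_univ_three, Matrix.add_apply]
    ring

theorem A0_mulVec (x : Fin 3 → ℂ) :
    A0 *ᵥ x = ![-(x 1 + x 2), x 0 - x 2, (1 / 2 : ℝ) * (x 0 + x 1) + x 2] := by
  ext i
  fin_cases i <;>
  · simp [A0, Matrix.mulVec, dotProduct, Fin.sum_univ_three, Matrix.smul_apply]
    try ring

/-- The action of `T₁ T_{1½}`. -/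
theorem T1_mul_T1half_mulVec (σ : ℝ) {r : ℝ} (hr : 0 < r) (v : Fin 3 → ℂ) :
    (T1 σ r * T1half σ r) *ᵥ v =
      ![v 0 + (r ^ (2 - 2 * σ) : ℝ) * v 2 + ((r ^ (2 - 2 * σ)) ^ 3 : ℝ) * v 1,
        v 1 + (r ^ (2 - 2 * σ) + (r ^ (2 - 2 * σ)) ^ 2 : ℝ) * v 2 +
          ((r ^ (2 - 2 * σ)) ^ 3 : ℝ) * v 1,
        v 2 + (r ^ (2 - 2 * σ) : ℝ) * v 0 + (r ^ (2 - 2 * σ) + (r ^ (2 - 2 * σ)) ^ 2 : ℝ) * v 1 +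
          ((r ^ (2 - 2 * σ)) ^ 3 : ℝ) * v 2] := by
  have h : r ^ (4 - 4 * σ) = (r ^ (2 - 2 * σ)) ^ 2 := by
    rw [← Real.rpow_natCast, ← Real.rpow_mul hr.le]; congr 1; push_cast; ring
  rw [T1, T1half, h, ← Matrix.mulVec_mulVec]
  generalize r ^ (2 - 2 * σ) = δ
  ext i
  fin_cases i <;>
  · simp [Matrix.mulVec, dotProduct, Fin.sum_univ_three, Matrix.add_apply,
      Matrix.one_apply]
    ring

theorem T0_mulVec (v : Fin 3 → ℂ) : T0 *ᵥ v = ![-v 0 + v 2, v 0 + v 2, v 1] := by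
  ext i
  fin_cases i <;> simp [T0, Matrix.mulVec, dotProduct, Fin.sum_univ_three]

theorem isUnit_det_T0 : IsUnit T0.det := by
  have : T0.det = 2 := by
    rw [T0, Matrix.det_fin_three]
    simp
    norm_num
  rw [this]
  simp

theorem det_T1 (σ r : ℝ) : (T1 σ r).det = ((1 - 2 * (r ^ (2 - 2 * σ)) ^ 2 : ℝ) : ℂ) := by
  rw [T1, Matrix.det_fin_three]
  simp
  ring

theorem det_T1half (σ r : ℝ) : (T1half σ r).det = ((1 - (r ^ (4 - 4 * σ)) ^ 2 : ℝ) : ℂ) := by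
  rw [T1half, Matrix.det_fin_three]
  simp
  ring

theorem isUnit_det_T1 {σ r : ℝ} (hr : 0 < r) (h : r ^ (2 - 2 * σ) ≤ 1 / 4) :
    IsUnit (T1 σ r).det := by
  have : 0 < r ^ (2 - 2 * σ) := Real.rpow_pos_of_pos hr _
  rw [det_T1, isUnit_iff_ne_zero, Complex.ofReal_ne_zero]
  nlinarith

theorem isUnit_det_T1half {σ r : ℝ} (hr : 0 < r) (h : r ^ (2 - 2 * σ) ≤ 1 / 4) :
    IsUnit (T1half σ r).det := by
  have h1 : 0 < r ^ (2 - 2 * σ) := Real.rpow_pos_of_pos hr _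
  have h2 : r ^ (4 - 4 * σ) = (r ^ (2 - 2 * σ)) ^ 2 := by
    rw [← Real.rpow_natCast, ← Real.rpow_mul hr.le]; congr 1; push_cast; ring
  rw [det_T1half, isUnit_iff_ne_zero, Complex.ofReal_ne_zero, h2]
  have h3 : (r ^ (2 - 2 * σ)) ^ 2 ≤ 1 / 2 := by nlinarith
  nlinarith [sq_nonneg (r ^ (2 - 2 * σ))]

/-- The bound δ ≤ 1/4 matters because the matrix inverse is zero at singular matrices; it keeps det
T₁ = 1 - 2δ² and det T_{1½} = 1 - δ⁴ away from zero. -/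
theorem weak_transform_inverse_mulVec {σ r : ℝ} (hr : 0 < r) (h : r ^ (2 - 2 * σ) ≤ 1 / 4)
    (x : Fin 3 → ℂ) :
    T0 *ᵥ ((T1 σ r * T1half σ r) *ᵥ (((T1half σ r)⁻¹ * (T1 σ r)⁻¹ * T0⁻¹) *ᵥ x)) = x := by
  have e : T0 * ((T1 σ r * T1half σ r) * ((T1half σ r)⁻¹ * (T1 σ r)⁻¹ * T0⁻¹)) =
      T0 * (T1 σ r * (T1half σ r * (T1half σ r)⁻¹) * (T1 σ r)⁻¹) * T0⁻¹ := by
    simp only [Matrix.mul_assoc]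
  rw [Matrix.mulVec_mulVec, Matrix.mulVec_mulVec, Matrix.mul_assoc T0, e,
    Matrix.mul_nonsing_inv _ (isUnit_det_T1half hr h), Matrix.mul_one, Matrix.mul_nonsing_inv _ (isUnit_det_T1 hr h),
    Matrix.mul_one, Matrix.mul_nonsing_inv _ isUnit_det_T0, Matrix.one_mulVec]

theorem map_ofReal_mul (l : ℂ →L[ℝ] ℝ) (a : ℝ) (z : ℂ) : l ((a : ℂ) * z) = a * l z := by
  rw [← Complex.real_smul, map_smul, smul_eq_mul]

theorem hasDerivAt_comp_coord {f : ℝ → Fin 3 → ℂ} {f' : Fin 3 → ℂ} {t : ℝ} (l : ℂ →L[ℝ] ℝ)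
    (h : HasDerivAt f f' t) (i : Fin 3) : HasDerivAt (fun τ => l (f τ i)) (l (f' i)) t :=
  l.hasFDerivAt.comp_hasDerivAt t (hasDerivAt_pi.1 h i)

theorem continuousOn_comp_coord {f : ℝ → Fin 3 → ℂ} {s : Set ℝ} (l : ℂ →L[ℝ] ℝ)
    (h : ContinuousOn f s) (i : Fin 3) : ContinuousOn (fun τ => l (f τ i)) s :=
  l.continuous.comp_continuousOn (continuousOn_pi.1 h i)

/-- The comparison estimate for one real component of the low-frequency weak-damping solution. -/
theorem abs_comp_sub_le_weak {σ r : ℝ} (hr : 0 < r) (h : r ^ (2 - 2 * σ) ≤ 1 / 4)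
    {w v : ℝ → Fin 3 → ℂ} (hw : ContinuousOn w (Ici 0))
    (dw : ∀ t, 0 < t → HasDerivAt w (-(symbolA σ r *ᵥ w t)) t)
    (hv : ContinuousOn v (Ici 0))
    (dv : ∀ t, 0 < t → HasDerivAt v (-(refSymbol σ r *ᵥ v t)) t)
    (h0 : T0 *ᵥ ((T1 σ r * T1half σ r) *ᵥ v 0) = w 0) (l : ℂ →L[ℝ] ℝ) {M : ℝ}
    (h₁ : |(l (w 0 1) - l (w 0 0)) / 2| ≤ M) (h₂ : |l (w 0 2)| ≤ M)
    (h₃ : |(l (w 0 0) + l (w 0 1)) / 2| ≤ M) {t : ℝ} (ht : 0 ≤ t) (j : Fin 3) :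
    |l ((w t - T0 *ᵥ ((T1 σ r * T1half σ r) *ᵥ v t)) j)| ≤
      80 * Real.exp 12 * (r ^ (2 - 2 * σ) * M) * Real.exp (-(r ^ (4 - 2 * σ) * t / 32)) := by
  obtain ⟨ρ, hρd⟩ : ∃ ρ, ρ = r ^ (2 * σ) := ⟨_, rfl⟩
  have hρ : 0 < ρ := hρd ▸ Real.rpow_pos_of_pos hr _
  have hδ : 0 < r ^ (2 - 2 * σ) := Real.rpow_pos_of_pos hr _
  have e₂ : r ^ 2 = ρ * r ^ (2 - 2 * σ) := by
    rw [hρd, ← Real.rpow_add hr, ← Real.rpow_natCast]; congr 1; push_cast; ring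
  have e₄ : r ^ (4 - 2 * σ) = ρ * (r ^ (2 - 2 * σ)) ^ 2 := by
    rw [hρd, ← Real.rpow_natCast, ← Real.rpow_mul hr.le, ← Real.rpow_add hr]
    congr 1; push_cast; ring
  have dwl : ∀ t, 0 < t → ∀ i, HasDerivAt (fun τ => l (w τ i)) (l ((-(symbolA σ r *ᵥ w t)) i)) t :=
    fun t ht i => hasDerivAt_comp_coord l (dw t ht) i
  have cwl := continuousOn_comp_coord l hw
  have dvl : ∀ t, 0 < t → ∀ i, HasDerivAt (fun τ => l (v τ i)) (l ((-(refSymbol σ r *ᵥ v t)) i)) t :=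
    fun t ht i => hasDerivAt_comp_coord l (dv t ht) i
  have cvl := continuousOn_comp_coord l hv
  simp only [T1_mul_T1half_mulVec σ hr, T0_mulVec, symbolA_mulVec, refSymbol] at dwl dvl h0 ⊢
  rw [e₄] at *
  rw [← hρd] at *
  generalize r ^ (2 - 2 * σ) = δ at *
  simp only [e₂] at dwl dvl
  have hv₁ : ∀ t, 0 ≤ t → l (v t 0) = Real.exp (-(ρ * δ ^ 2 * t)) * l (v 0 0) := fun t ht =>
    real_eq_exp_mul_of_hasDerivAt (cvl 0) (fun t ht => (dvl t ht 0).congr_deriv (by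
      simp only [Pi.neg_apply, Matrix.mulVec_diagonal, map_neg, Matrix.cons_val_zero,
        map_ofReal_mul])) ht
  have hv₂ : ∀ t, 0 ≤ t → l (v t 1) = Real.exp (-(ρ * δ * t)) * l (v 0 1) := fun t ht =>
    real_eq_exp_mul_of_hasDerivAt (cvl 1) (fun t ht => (dvl t ht 1).congr_deriv (by
      simp only [Pi.neg_apply, Matrix.mulVec_diagonal, map_neg, Matrix.cons_val_one,
        Matrix.cons_val_zero, map_ofReal_mul])) ht
  have hv₃ : ∀ t, 0 ≤ t → l (v t 2) = Real.exp (-(ρ * t)) * l (v 0 2) := fun t ht =>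
    real_eq_exp_mul_of_hasDerivAt (cvl 2) (fun t ht => (dvl t ht 2).congr_deriv (by
      simp only [Pi.neg_apply, Matrix.mulVec_diagonal, map_neg, Matrix.cons_val,
        map_ofReal_mul])) ht
  have l0 : l (w 0 0) = -(l (v 0 0) + δ * l (v 0 2) + δ ^ 3 * l (v 0 1)) +
      (l (v 0 2) + δ * l (v 0 0) + (δ + δ ^ 2) * l (v 0 1) + δ ^ 3 * l (v 0 2)) := by
    rw [← h0]; simp [map_ofReal_mul, -Complex.ofReal_add, -Complex.ofReal_pow]
  have l1 : l (w 0 1) = (l (v 0 0) + δ * l (v 0 2) + δ ^ 3 * l (v 0 1)) +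
      (l (v 0 2) + δ * l (v 0 0) + (δ + δ ^ 2) * l (v 0 1) + δ ^ 3 * l (v 0 2)) := by
    rw [← h0]; simp [map_ofReal_mul, -Complex.ofReal_add, -Complex.ofReal_pow]
  have l2 : l (w 0 2) = l (v 0 1) + (δ + δ ^ 2) * l (v 0 2) + δ ^ 3 * l (v 0 1) := by
    rw [← h0]; simp [map_ofReal_mul, -Complex.ofReal_add, -Complex.ofReal_pow]
  -- These combinations are the components of T₀⁻¹w; undoing them through -c₁ + c₃, c₁ + c₃ and c₂
  -- at most doubles the error.
  obtain ⟨b₁, b₂, b₃⟩ := abs_sub_le_of_weak_system hρ hδ h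
    (c₁ := fun t => (l (w t 1) - l (w t 0)) / 2) (c₂ := fun t => l (w t 2))
    (c₃ := fun t => (l (w t 0) + l (w t 1)) / 2)
    (((cwl 1).sub (cwl 0)).div_const 2) (cwl 2) (((cwl 0).add (cwl 1)).div_const 2)
    (fun t ht => (((dwl t ht 1).fun_sub (dwl t ht 0)).div_const 2).congr_deriv (by
      simp only [Pi.neg_apply, map_neg, Matrix.cons_val_one, Matrix.cons_val_zero, map_ofReal_mul,
        map_add, map_sub]
      ring))
    (fun t ht => (dwl t ht 2).congr_deriv (by
      simp only [Pi.neg_apply, map_neg, Matrix.cons_val, map_ofReal_mul, map_add]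
      ring))
    (fun t ht => (((dwl t ht 0).fun_add (dwl t ht 1)).div_const 2).congr_deriv (by
      simp only [Pi.neg_apply, map_neg, Matrix.cons_val_one, Matrix.cons_val_zero, map_ofReal_mul,
        map_add, map_sub]
      ring))
    h₁ h₂ h₃ (v₁ := fun t => l (v t 0)) (v₂ := fun t => l (v t 1)) (v₃ := fun t => l (v t 2))
    hv₁ hv₂ hv₃ (by rw [l0, l1]; ring) (by rw [l2]) (by rw [l0, l1]; ring) ht
  have hpos : 0 ≤ 40 * Real.exp 12 * (δ * M) * Real.exp (-(ρ * δ ^ 2 * t / 32)) :=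
    (abs_nonneg _).trans b₁
  rw [abs_le] at b₁ b₂ b₃ ⊢
  fin_cases j
  · simp [map_ofReal_mul, -Complex.ofReal_add, -Complex.ofReal_pow]
    constructor <;> linarith only [b₁.1, b₁.2, b₃.1, b₃.2]
  · simp [map_ofReal_mul, -Complex.ofReal_add, -Complex.ofReal_pow]
    constructor <;> linarith only [b₁.1, b₁.2, b₃.1, b₃.2]
  · simp [map_ofReal_mul, -Complex.ofReal_add, -Complex.ofReal_pow]
    constructor <;> linarith only [b₂.1, b₂.2, hpos]

/-- The comparison estimate for one real component of the low-frequency strong-damping solution. -/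
theorem abs_comp_sub_le_strong {σ r : ℝ} (hr : 0 < r) (h : r ^ (2 * σ - 2) ≤ 1 / 4)
    {w z : ℝ → Fin 3 → ℂ} (hw : ContinuousOn w (Ici 0))
    (dw : ∀ t, 0 < t → HasDerivAt w (-(symbolA σ r *ᵥ w t)) t)
    (hz : ContinuousOn z (Ici 0))
    (dz : ∀ t, 0 < t → HasDerivAt z (-(((r ^ 2 : ℝ) : ℂ) • (A0 *ᵥ z t))) t)
    (h0 : z 0 = w 0) (l : ℂ →L[ℝ] ℝ) {M : ℝ}
    (h₁ : |(l (w 0 1) - l (w 0 0)) / 2| ≤ M) (h₂ : |l (w 0 2)| ≤ M)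
    (h₃ : |(l (w 0 0) + l (w 0 1)) / 2| ≤ M) {t : ℝ} (ht : 0 ≤ t) (j : Fin 3) :
    |l ((w t - z t) j)| ≤
      628 * (r ^ (2 * σ - 2) * M) * Real.exp (-(r ^ 2 * t / 128)) := by
  have hδ : 0 < r ^ (2 * σ - 2) := Real.rpow_pos_of_pos hr _
  have hβ : 0 < r ^ 2 := by positivity
  have e₂ : r ^ (2 * σ) = r ^ 2 * r ^ (2 * σ - 2) := by
    rw [← Real.rpow_natCast r 2, ← Real.rpow_add hr]; congr 1; push_cast; ring
  have dwl : ∀ t, 0 < t → ∀ i, HasDerivAt (fun τ => l (w τ i)) (l ((-(symbolA σ r *ᵥ w t)) i)) t :=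
    fun t ht i => hasDerivAt_comp_coord l (dw t ht) i
  have cwl := continuousOn_comp_coord l hw
  have dzl : ∀ t, 0 < t → ∀ i, HasDerivAt (fun τ => l (z τ i))
      (l ((-(((r ^ 2 : ℝ) : ℂ) • (A0 *ᵥ z t))) i)) t :=
    fun t ht i => hasDerivAt_comp_coord l (dz t ht) i
  have czl := continuousOn_comp_coord l hz
  simp only [symbolA_mulVec, A0_mulVec] at dwl dzl
  rw [e₂] at *
  generalize r ^ (2 * σ - 2) = δ at *
  generalize r ^ 2 = β at *
  rw [← h0] at h₁ h₂ h₃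
  obtain ⟨b₁, b₂, b₃⟩ := abs_sub_le_of_strong_system hβ hδ.le h
    (c₁ := fun t => (l (w t 1) - l (w t 0)) / 2) (c₂ := fun t => l (w t 2))
    (c₃ := fun t => (l (w t 0) + l (w t 1)) / 2)
    (((cwl 1).sub (cwl 0)).div_const 2) (cwl 2) (((cwl 0).add (cwl 1)).div_const 2)
    (fun t ht => (((dwl t ht 1).fun_sub (dwl t ht 0)).div_const 2).congr_deriv (by
      simp only [Pi.neg_apply, map_neg, Matrix.cons_val_one, Matrix.cons_val_zero, map_ofReal_mul,
        map_add, map_sub]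
      ring))
    (fun t ht => (dwl t ht 2).congr_deriv (by
      simp only [Pi.neg_apply, map_neg, Matrix.cons_val, map_ofReal_mul, map_add]
      ring))
    (fun t ht => (((dwl t ht 0).fun_add (dwl t ht 1)).div_const 2).congr_deriv (by
      simp only [Pi.neg_apply, map_neg, Matrix.cons_val_one, Matrix.cons_val_zero, map_ofReal_mul,
        map_add, map_sub]
      ring))
    (z₁ := fun t => (l (z t 1) - l (z t 0)) / 2) (z₂ := fun t => l (z t 2))
    (z₃ := fun t => (l (z t 0) + l (z t 1)) / 2)
    (((czl 1).sub (czl 0)).div_const 2) (czl 2) (((czl 0).add (czl 1)).div_const 2)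
    (fun t ht => (((dzl t ht 1).fun_sub (dzl t ht 0)).div_const 2).congr_deriv (by
      simp only [Pi.neg_apply, Pi.smul_apply, smul_eq_mul, map_neg, Matrix.cons_val_one,
        Matrix.cons_val_zero, map_ofReal_mul, map_add, map_sub]
      ring))
    (fun t ht => (dzl t ht 2).congr_deriv (by
      simp only [Pi.neg_apply, Pi.smul_apply, smul_eq_mul, map_neg, Matrix.cons_val,
        map_ofReal_mul, map_add]
      ring))
    (fun t ht => (((dzl t ht 0).fun_add (dzl t ht 1)).div_const 2).congr_deriv (by
      simp only [Pi.neg_apply, Pi.smul_apply, smul_eq_mul, map_neg, Matrix.cons_val_one,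
        Matrix.cons_val_zero, map_ofReal_mul, map_add, map_sub]
      ring))
    h₁ h₂ h₃ (by rw [h0]) (by rw [h0]) (by rw [h0]) ht
  have hpos : 0 ≤ 314 * (δ * M) * Real.exp (-(β * t / 128)) := (abs_nonneg _).trans b₁
  rw [abs_le] at b₁ b₂ b₃ ⊢
  rw [Pi.sub_apply, map_sub]
  match j with
  | 0 => constructor <;> linarith only [b₁.1, b₁.2, b₃.1, b₃.2]
  | 1 => constructor <;> linarith only [b₁.1, b₁.2, b₃.1, b₃.2]
  | 2 => constructor <;> linarith only [b₂.1, b₂.2, hpos]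

/-! ### From frequency weights to decay in time. -/

/-- Half of the exponential absorbs x^b, through the term of order ⌈b⌉ of its power series; the
other half dominates a Gaussian because x² ≤ 1 + x^a. -/
theorem exists_rpow_mul_exp_le {a b κ : ℝ} (ha : 2 ≤ a) (hκ : 0 < κ) :
    ∃ C : ℝ, 0 < C ∧ ∀ x : ℝ, 0 ≤ x → 0 ≤ b →
      x ^ b * Real.exp (-(κ * x ^ a)) ≤ C * Real.exp (-(κ / 2 * x ^ 2)) := by
  set k := ⌈b⌉₊ with hk
  refine ⟨Real.exp (κ / 2) * (1 + (2 / κ) ^ k * k.factorial), by positivity, fun x hx hb => ?_⟩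
  have hxa : 0 ≤ x ^ a := Real.rpow_nonneg hx a
  have hsq : x ^ 2 ≤ 1 + x ^ a := by
    rcases le_total x 1 with h | h
    · have : x ^ 2 ≤ 1 := pow_le_one₀ hx h
      linarith
    · have := Real.rpow_le_rpow_of_exponent_le h ha
      rw [Real.rpow_two] at this
      linarith
  have hpow : x ^ b ≤ (1 + (2 / κ) ^ k * k.factorial) * Real.exp (κ / 2 * x ^ a) := by
    have he : 1 ≤ Real.exp (κ / 2 * x ^ a) := Real.one_le_exp (by positivity)
    rcases le_total x 1 with h | h
    · have h1 : x ^ b ≤ 1 := Real.rpow_le_one hx h hb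
      have h2 : 0 ≤ (2 / κ) ^ k * k.factorial * Real.exp (κ / 2 * x ^ a) := by positivity
      linarith
    · have h1 : x ^ b ≤ (x ^ a) ^ k := by
        rw [← Real.rpow_natCast, ← Real.rpow_mul hx]
        apply Real.rpow_le_rpow_of_exponent_le h
        have : b ≤ k := Nat.le_ceil b
        have h3 : (0 : ℝ) ≤ k := k.cast_nonneg
        nlinarith
      have h2 := Real.pow_div_factorial_le_exp (κ / 2 * x ^ a) (by positivity) k
      rw [div_le_iff₀ (by positivity), mul_pow] at h2
      have h3 : (x ^ a) ^ k = (2 / κ) ^ k * ((κ / 2) ^ k * (x ^ a) ^ k) := by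
        rw [← mul_assoc, ← mul_pow]
        have : 2 / κ * (κ / 2) = 1 := by field_simp
        rw [this, one_pow, one_mul]
      have h4 := mul_le_mul_of_nonneg_left h2 (show 0 ≤ (2 / κ) ^ k by positivity)
      rw [← h3] at h4
      have := Real.exp_pos (κ / 2 * x ^ a)
      linarith
  calc x ^ b * Real.exp (-(κ * x ^ a))
      ≤ (1 + (2 / κ) ^ k * k.factorial) * Real.exp (κ / 2 * x ^ a) * Real.exp (-(κ * x ^ a)) := by
        gcongr
    _ = (1 + (2 / κ) ^ k * k.factorial) * Real.exp (-(κ / 2 * x ^ a)) := by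
        rw [mul_assoc, ← Real.exp_add]; congr 2; ring
    _ ≤ (1 + (2 / κ) ^ k * k.factorial) * (Real.exp (κ / 2) * Real.exp (-(κ / 2 * x ^ 2))) := by
        rw [← Real.exp_add]
        gcongr
        have := mul_le_mul_of_nonneg_left hsq (show 0 ≤ κ / 2 by positivity)
        linarith
    _ = _ := by ring

/-- The preceding bound at x = r(1+t)^{1/a}. Replacing t by 1+t costs only e^κ since r ≤ 1. -/
theorem exists_rpow_mul_exp_time_le {a b κ : ℝ} (ha : 2 ≤ a) (hb : 0 ≤ b) (hκ : 0 < κ) :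
    ∃ C : ℝ, 0 < C ∧ ∀ r t : ℝ, 0 ≤ r → r ≤ 1 → 0 ≤ t →
      r ^ b * Real.exp (-(κ * (r ^ a * t))) ≤
        C * (1 + t) ^ (-(b / a)) * Real.exp (-(κ / 2 * ((1 + t) ^ (2 / a) * r ^ 2))) := by
  obtain ⟨C, hC, h⟩ := exists_rpow_mul_exp_le (b := b) ha hκ
  refine ⟨Real.exp κ * C, by positivity, fun r t hr hr1 ht => ?_⟩
  have ht1 : 0 < 1 + t := by linarith
  have ha0 : 0 < a := by linarith
  have hx := h (r * (1 + t) ^ (1 / a)) (by positivity) hb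
  rw [Real.mul_rpow hr (by positivity), Real.mul_rpow hr (by positivity), mul_pow,
    ← Real.rpow_mul ht1.le, ← Real.rpow_mul ht1.le, ← Real.rpow_natCast (_ ^ _) 2,
    ← Real.rpow_mul ht1.le, one_div_mul_cancel ha0.ne', Real.rpow_one] at hx
  have e1 : 1 / a * b = b / a := by ring
  have e2 : 1 / a * ((2 : ℕ) : ℝ) = 2 / a := by push_cast; ring
  rw [e1, e2] at hx
  have hra : r ^ a ≤ 1 := Real.rpow_le_one hr hr1 ha0.le
  have hexp : Real.exp (-(κ * (r ^ a * t))) ≤ Real.exp κ * Real.exp (-(κ * (r ^ a * (1 + t)))) := by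
    rw [← Real.exp_add, Real.exp_le_exp]
    have := mul_le_mul_of_nonneg_left hra hκ.le
    linarith
  rw [Real.rpow_neg ht1.le]
  have hq : 0 < (1 + t) ^ (b / a) := by positivity
  calc r ^ b * Real.exp (-(κ * (r ^ a * t)))
      ≤ r ^ b * (Real.exp κ * Real.exp (-(κ * (r ^ a * (1 + t))))) := by gcongr
    _ = Real.exp κ * ((1 + t) ^ (b / a))⁻¹ *
          (r ^ b * (1 + t) ^ (b / a) * Real.exp (-(κ * (r ^ a * (1 + t))))) := by
        field_simp
    _ ≤ Real.exp κ * ((1 + t) ^ (b / a))⁻¹ *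
          (C * Real.exp (-(κ / 2 * (r ^ 2 * (1 + t) ^ (2 / a))))) := by gcongr
    _ = _ := by rw [mul_comm (r ^ 2)]; ring

/-- The bridge used in both regimes. Only |g| enters, and C is chosen before f, g and t, which gives
uniformity in the data and in the diagonalising matrix. -/
theorem exists_cutoffHomNorm_le {n : ℕ} (hn : 1 ≤ n) {a γ κ K s ε : ℝ} (ha : 2 ≤ a) (hγ : 0 ≤ γ)
    (hκ : 0 < κ) (hK : 0 < K) (hs : 0 ≤ s) (hε : ε ≤ 1) {p q : ℝ≥0∞} (hp1 : 1 ≤ p) (hp : p ≤ 2)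
    (hq : 2 ≤ q) {χ : Rn n → ℝ} (hχ : ContDiff ℝ ∞ χ)
    (hsupp : tsupport χ ⊆ Metric.closedBall 0 ε) :
    ∃ C : ℝ, 0 < C ∧ ∀ (f : Fin 3 → 𝓢(Rn n, ℂ)) (g : Rn n → Fin 3 → ℂ) (t : ℝ), 0 ≤ t →
      (∀ j, Measurable fun ξ => g ξ j) →
      (∀ ξ, 0 < ‖ξ‖ → ‖ξ‖ ≤ ε → ∀ j, ‖g ξ j‖ ≤
        K * (‖ξ‖ ^ γ * Real.exp (-(κ * (‖ξ‖ ^ a * t)))) * ∑ i, ‖angularFourier (f i) ξ‖) →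
      (∀ j, Integrable (cutoffSymbol s χ g j) volume) ∧
      cutoffHomNorm s q χ g ≤
        ENNReal.ofReal (C * (1 + t) ^
          (-(s / a) - n / a * ((p⁻¹).toReal - (q⁻¹).toReal) - γ / a)) *
        ∑ i, eLpNorm (f i) p volume := by
  obtain ⟨C₀, hC₀, hw⟩ := exists_rpow_mul_exp_time_le ha (add_nonneg hs hγ) hκ
  have hcomp : HasCompactSupport χ :=
    (isCompact_closedBall (0 : Rn n) ε).of_isClosed_subset (isClosed_tsupport χ) hsupp
  obtain ⟨B, hB⟩ := hcomp.exists_bound_of_continuous hχ.continuous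
  have hB0 : 0 ≤ B := (norm_nonneg _).trans (hB 0)
  have hχ0 : ∀ ξ, ε < ‖ξ‖ → χ ξ = 0 := fun ξ hξ => by
    by_contra h
    have := hsupp (subset_tsupport χ h)
    rw [mem_closedBall_zero_iff] at this
    linarith
  have hpi := Real.pi_pos
  set e : ℝ := (n : ℝ) / 2 * ((p⁻¹).toReal - (q⁻¹).toReal) with he
  set C₁ : ℝ := (B + 1) * K * C₀ with hC₁
  refine ⟨3 * (C₁ * (1 / (2 * Real.pi * κ)) ^ e), by positivity, fun f g t ht hg hb => ?_⟩
  have ht1 : 0 < 1 + t := by linarith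
  -- In positive dimension the origin is a null set, so the hypothesis for nonzero frequencies
  -- suffices.
  have : Nonempty (Fin n) := ⟨⟨0, hn⟩⟩
  -- With ξ = 2πη, this makes (κ/2)(1+t)^{2/a}|ξ|² equal to 2τ|η|².
  set τ : ℝ := κ * Real.pi ^ 2 * (1 + t) ^ (2 / a) with hτ
  have hτ0 : 0 < τ := by positivity
  have h2pi : (0 : ℝ) < 2 * Real.pi := by positivity
  have hmeas : ∀ j, Measurable (cutoffSymbol s χ g j) := fun j => by
    have := hg j
    have := hχ.continuous.measurable
    unfold cutoffSymbol
    fun_prop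
  have hbound : ∀ j, ∀ᵐ η : Rn n, ‖cutoffSymbol s χ g j ((2 * Real.pi) • η)‖ ≤
      (C₁ * (1 + t) ^ (-((s + γ) / a))) * Real.exp (-(2 * τ) * ‖η‖ ^ 2) *
        ∑ i, ‖𝓕 (f i : Rn n → ℂ) η‖ := by
    intro j
    have hne : ∀ᵐ η : Rn n, η ≠ 0 := by
      rw [ae_iff]
      simp
    filter_upwards [hne] with η hη
    have hF : ∀ i, angularFourier (f i) ((2 * Real.pi) • η) = 𝓕 (f i : Rn n → ℂ) η := fun i => by
      rw [angularFourier, smul_smul, inv_mul_cancel₀ h2pi.ne', one_smul]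
    rcases lt_or_ge ε ‖(2 * Real.pi) • η‖ with h | h
    · rw [cutoffSymbol, hχ0 _ h]
      simp
      positivity
    · have hξ0 : 0 < ‖(2 * Real.pi) • η‖ := norm_pos_iff.2 (smul_ne_zero h2pi.ne' hη)
      have h1 := hb _ hξ0 h j
      simp only [hF] at h1
      have h2 := hw ‖(2 * Real.pi) • η‖ t hξ0.le (h.trans hε) ht
      have h3 : ‖(2 * Real.pi) • η‖ ^ 2 = 4 * Real.pi ^ 2 * ‖η‖ ^ 2 := by
        rw [norm_smul, Real.norm_of_nonneg h2pi.le]; ring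
      have h4 : -(κ / 2 * ((1 + t) ^ (2 / a) * ‖(2 * Real.pi) • η‖ ^ 2)) =
          -(2 * τ) * ‖η‖ ^ 2 := by rw [h3, hτ]; ring
      rw [h4, Real.rpow_add hξ0] at h2
      rw [cutoffSymbol, norm_mul, Complex.norm_real, norm_mul,
        Real.norm_of_nonneg (Real.rpow_nonneg hξ0.le s)]
      set ξ := (2 * Real.pi) • η
      set D := ∑ i, ‖𝓕 (f i : Rn n → ℂ) η‖ with hD
      have hD0 : 0 ≤ D := by positivity
      calc ‖ξ‖ ^ s * ‖χ ξ‖ * ‖g ξ j‖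
          ≤ ‖ξ‖ ^ s * (B + 1) * (K * (‖ξ‖ ^ γ * Real.exp (-(κ * (‖ξ‖ ^ a * t)))) * D) := by
            gcongr
            exact (hB ξ).trans (by linarith)
        _ = (B + 1) * K * (‖ξ‖ ^ s * ‖ξ‖ ^ γ * Real.exp (-(κ * (‖ξ‖ ^ a * t)))) * D := by ring
        _ ≤ (B + 1) * K * (C₀ * (1 + t) ^ (-((s + γ) / a)) *
              Real.exp (-(2 * τ) * ‖η‖ ^ 2)) * D := by gcongr
        _ = _ := by rw [hC₁]; ring
  have hmain := fun j => fourierInv_bound_of_gaussian_domination hτ0 f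
    (((hmeas j).comp (measurable_const_smul (2 * Real.pi))).aestronglyMeasurable)
    (by positivity) (hbound j) hp1 hp hq
  have hconst : C₁ * (1 + t) ^ (-((s + γ) / a)) * (Real.pi / (2 * τ)) ^
        ((Module.finrank ℝ (Rn n) / 2 : ℝ) * ((p⁻¹).toReal - (q⁻¹).toReal)) =
      C₁ * (1 / (2 * Real.pi * κ)) ^ e *
        (1 + t) ^ (-(s / a) - n / a * ((p⁻¹).toReal - (q⁻¹).toReal) - γ / a) := by
    rw [finrank_euclideanSpace_fin, ← he]
    have : Real.pi / (2 * τ) = 1 / (2 * Real.pi * κ) * (1 + t) ^ (-(2 / a)) := by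
      rw [hτ, Real.rpow_neg ht1.le]
      field_simp
    rw [this, Real.mul_rpow (by positivity) (by positivity), ← Real.rpow_mul ht1.le]
    have h5 : (1 + t) ^ (-(s / a) - n / a * ((p⁻¹).toReal - (q⁻¹).toReal) - γ / a) =
        (1 + t) ^ (-((s + γ) / a)) * (1 + t) ^ (-(2 / a) * e) := by
      rw [← Real.rpow_add ht1]
      congr 1
      rw [he]
      ring
    rw [h5]
    ring
  refine ⟨fun j => (integrable_comp_smul_iff volume _ h2pi.ne').1 (hmain j).1, ?_⟩
  calc cutoffHomNorm s q χ g
      ≤ ∑ _j : Fin 3, ENNReal.ofReal (C₁ * (1 / (2 * Real.pi * κ)) ^ e *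
        (1 + t) ^ (-(s / a) - n / a * ((p⁻¹).toReal - (q⁻¹).toReal) - γ / a)) *
          ∑ i, eLpNorm (f i) p volume := by
        refine Finset.sum_le_sum fun j _ => ?_
        rw [← hconst]
        exact (hmain j).2
    _ = _ := by
        rw [Finset.sum_const, Finset.card_univ, Fintype.card_fin, nsmul_eq_mul, ← mul_assoc]
        congr 1
        rw [mul_assoc 3 _ _, ENNReal.ofReal_mul (by norm_num : (0 : ℝ) ≤ 3)]
        norm_num

/-! ### Uniqueness and measurability of solutions in the frequency variable. -/

theorem eq_of_hasDerivAt_zero {f : ℝ → Fin 3 → ℂ} (hf : ContinuousOn f (Ici 0))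
    (hf' : ∀ t, 0 < t → HasDerivAt f 0 t) {t : ℝ} (ht : 0 ≤ t) : f t = f 0 := by
  have key : ∀ (l : ℂ →L[ℝ] ℝ) i, l (f t i) = l (f 0 i) := fun l i => by
    have := real_eq_exp_mul_of_hasDerivAt (l := 0) (continuousOn_comp_coord l hf i)
      (fun t ht => by simpa using hasDerivAt_comp_coord l (hf' t ht) i) ht
    simpa using this
  funext i
  exact Complex.ext (key Complex.reCLM i) (key Complex.imCLM i)

theorem exp_zero_smul_apply {E : Type*} [NormedAddCommGroup E] [NormedSpace ℝ E] (A : E →L[ℝ] E)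
    (x : E) : NormedSpace.exp ((0 : ℝ) • A) x = x := by
  rw [zero_smul, NormedSpace.exp_zero]
  rfl

section Exponential

variable {E : Type*} [NormedAddCommGroup E] [NormedSpace ℝ E] [CompleteSpace E]

theorem hasDerivAt_exp_smul_apply {A : E →L[ℝ] E} {w : ℝ → E} {t : ℝ}
    (h : HasDerivAt w (-(A (w t))) t) :
    HasDerivAt (fun t : ℝ => NormedSpace.exp (t • A) (w t)) 0 t := by
  refine ((hasDerivAt_exp_smul_const A t).clm_apply h).congr_deriv ?_
  simp

theorem continuous_clm_exp : Continuous (NormedSpace.exp : (E →L[ℝ] E) → (E →L[ℝ] E)) :=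
  let : NormedAlgebra ℚ (E →L[ℝ] E) := NormedAlgebra.restrictScalars ℚ ℝ _
  NormedSpace.exp_continuous

theorem exp_neg_smul_apply_exp_smul (A : E →L[ℝ] E) (t : ℝ) (x : E) :
    NormedSpace.exp ((-t) • A) (NormedSpace.exp (t • A) x) = x := by
  let : NormedAlgebra ℚ (E →L[ℝ] E) := NormedAlgebra.restrictScalars ℚ ℝ _
  have hinv : NormedSpace.exp ((-t) • A) * NormedSpace.exp (t • A) = 1 := by
    rw [← NormedSpace.exp_add_of_commute]
    · simp
    · exact ((Commute.refl A).smul_left _).smul_right _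
  exact DFunLike.congr_fun hinv x

end Exponential

/-- Nothing relates the solutions at different ξ except the equation. For each ξ, e^{tA}w is
constant in time, so w(t, ξ) = e^{-tA(|ξ|)}w₀(ξ), which depends measurably on ξ. -/
theorem IsFourierSolution.measurable {n : ℕ} {M : ℝ → Matrix (Fin 3) (Fin 3) ℂ}
    {w₀ : Rn n → Fin 3 → ℂ} {w : ℝ → Rn n → Fin 3 → ℂ} (h : IsFourierSolution M w₀ w)
    (hM : ∀ i j, Measurable fun r => M r i j) (hw₀ : ∀ j, Measurable fun ξ => w₀ ξ j)
    {t : ℝ} (ht : 0 ≤ t) (j : Fin 3) : Measurable fun ξ => w t ξ j := by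
  -- Expanding in matrix units turns measurability of the entries into strong measurability in the
  -- space of operators.
  set Bm : Fin 3 → Fin 3 → ((Fin 3 → ℂ) →L[ℂ] (Fin 3 → ℂ)) := fun i j =>
    (Matrix.mulVecLin (Matrix.single i j (1 : ℂ))).toContinuousLinearMap with hBm
  set A : ℝ → ((Fin 3 → ℂ) →L[ℝ] (Fin 3 → ℂ)) := fun r =>
    ContinuousLinearMap.restrictScalarsL ℂ (Fin 3 → ℂ) (Fin 3 → ℂ) ℝ ℝ
      (∑ i, ∑ j, M r i j • Bm i j) with hA
  have hAx : ∀ r x, A r x = M r *ᵥ x := fun r x => by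
    have : M r *ᵥ x = (∑ i, ∑ j, M r i j • Matrix.single i j (1 : ℂ)) *ᵥ x := by
      conv_lhs => rw [Matrix.matrix_eq_sum_single (M r)]
      simp only [Matrix.smul_single, smul_eq_mul, mul_one]
    rw [this]
    simp [hA, hBm, Matrix.sum_mulVec, Matrix.smul_mulVec, -Matrix.smul_single]
  have hAm : StronglyMeasurable A := by
    refine (ContinuousLinearMap.continuous _).comp_stronglyMeasurable ?_
    refine Finset.stronglyMeasurable_fun_sum _ fun i _ =>
      Finset.stronglyMeasurable_fun_sum _ fun j _ => ?_
    exact (hM i j).stronglyMeasurable.smul_const _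
  have hsol : ∀ ξ, w t ξ = NormedSpace.exp ((-t) • A ‖ξ‖) (w₀ ξ) := fun ξ => by
    obtain ⟨h0, hc, hd⟩ := h ξ
    have hexpc : Continuous fun t : ℝ => NormedSpace.exp (t • A ‖ξ‖) :=
      continuous_clm_exp.comp (by fun_prop)
    have hconst := eq_of_hasDerivAt_zero
      (f := fun t => NormedSpace.exp (t • A ‖ξ‖) (w t ξ)) (hexpc.continuousOn.clm_apply hc)
      (fun t ht => hasDerivAt_exp_smul_apply (by rw [hAx]; exact hd t ht)) ht
    rw [exp_zero_smul_apply, h0] at hconst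
    rw [← hconst, exp_neg_smul_apply_exp_smul]
  have hE : StronglyMeasurable fun ξ : Rn n => NormedSpace.exp ((-t) • A ‖ξ‖) :=
    continuous_clm_exp.comp_stronglyMeasurable
      ((hAm.comp_measurable measurable_norm).const_smul (-t))
  have hw₀' : StronglyMeasurable w₀ := (measurable_pi_iff.2 hw₀).stronglyMeasurable
  have : StronglyMeasurable fun ξ => w t ξ := by
    simp_rw [hsol]
    exact isBoundedBilinearMap_apply.continuous.comp_stronglyMeasurable (hE.prodMk hw₀')
  exact (measurable_pi_apply j).comp this.measurable

theorem continuous_angularFourier {n : ℕ} (f : 𝓢(Rn n, ℂ)) :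
    Continuous (angularFourier (f : Rn n → ℂ)) :=
  (continuous_fourier_of_integrable f.integrable).comp (continuous_const_smul _)

theorem measurable_initialValue {n : ℕ} (v₀ u₁ θ₀ : 𝓢(Rn n, ℂ)) (j : Fin 3) :
    Measurable fun ξ => initialValue v₀ u₁ θ₀ ξ j := by
  have h₁ := (continuous_angularFourier v₀).measurable
  have h₂ := (continuous_angularFourier u₁).measurable
  have h₃ := (continuous_angularFourier θ₀).measurable
  match j with
  | 0 => exact h₂.add h₁
  | 1 => exact h₂.sub h₁
  | 2 => exact h₃

theorem measurable_mulVec {α : Type*} [MeasurableSpace α] {N : α → Matrix (Fin 3) (Fin 3) ℂ}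
    {x : α → Fin 3 → ℂ} (hN : ∀ i j, Measurable fun a => N a i j)
    (hx : ∀ j, Measurable fun a => x a j) (i : Fin 3) :
    Measurable fun a => (N a *ᵥ x a) i := by
  simp only [Matrix.mulVec, dotProduct]
  exact Finset.measurable_fun_sum _ fun j _ => (hN i j).mul (hx j)

theorem measurable_mul_entry {α : Type*} [MeasurableSpace α] {N N' : α → Matrix (Fin 3) (Fin 3) ℂ}
    (hN : ∀ i j, Measurable fun a => N a i j) (hN' : ∀ i j, Measurable fun a => N' a i j)
    (i j : Fin 3) : Measurable fun a => (N a * N' a) i j := by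
  simp only [Matrix.mul_apply]
  exact Finset.measurable_fun_sum _ fun k _ => (hN i k).mul (hN' k j)

theorem measurable_inv_entry {α : Type*} [MeasurableSpace α] {N : α → Matrix (Fin 3) (Fin 3) ℂ}
    (hN : ∀ i j, Measurable fun a => N a i j) (i j : Fin 3) :
    Measurable fun a => (N a)⁻¹ i j := by
  simp only [Matrix.inv_def, Ring.inverse_eq_inv', Matrix.smul_apply, smul_eq_mul,
    Matrix.det_fin_three, Matrix.adjugate_fin_three]
  fin_cases i <;> fin_cases j <;> simp <;> fun_prop

theorem measurable_symbolA_entry (σ : ℝ) (i j : Fin 3) : Measurable fun r => symbolA σ r i j := by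
  simp only [symbolA, Matrix.add_apply, Matrix.smul_apply, smul_eq_mul]
  fun_prop

theorem measurable_T1_entry (σ : ℝ) (i j : Fin 3) : Measurable fun r => T1 σ r i j := by
  simp only [T1, Matrix.add_apply, Matrix.smul_apply, smul_eq_mul]
  fun_prop

theorem measurable_T1half_entry (σ : ℝ) (i j : Fin 3) : Measurable fun r => T1half σ r i j := by
  simp only [T1half, Matrix.add_apply, Matrix.smul_apply, smul_eq_mul]
  fun_prop

theorem measurable_refSymbol_entry (σ : ℝ) (i j : Fin 3) :
    Measurable fun r => refSymbol σ r i j := by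
  fin_cases i <;> fin_cases j <;> simp [refSymbol, -Complex.ofReal_pow] <;> fun_prop

theorem measurable_refSymbolY_entry (i j : Fin 3) : Measurable fun r => refSymbolY r i j := by
  simp only [refSymbolY, Matrix.smul_apply, smul_eq_mul]
  fun_prop

/-! ### Pointwise comparison in frequency for the complex solutions. -/

theorem norm_le_two_mul_of_comp_le {z : ℂ} {B : ℝ}
    (h : ∀ l : ℂ →L[ℝ] ℝ, (∀ z, |l z| ≤ ‖z‖) → |l z| ≤ B) : ‖z‖ ≤ 2 * B := by
  have h1 := h Complex.reCLM Complex.abs_re_le_norm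
  have h2 := h Complex.imCLM Complex.abs_im_le_norm
  simp only [Complex.reCLM_apply, Complex.imCLM_apply] at h1 h2
  linarith [Complex.norm_le_abs_re_add_abs_im z]

theorem comp_initialValue_bounds {n : ℕ} (v₀ u₁ θ₀ : 𝓢(Rn n, ℂ)) (ξ : Rn n) {l : ℂ →L[ℝ] ℝ}
    (hl : ∀ z, |l z| ≤ ‖z‖) :
    |(l (initialValue v₀ u₁ θ₀ ξ 1) - l (initialValue v₀ u₁ θ₀ ξ 0)) / 2| ≤
      ∑ i, ‖angularFourier (![v₀, u₁, θ₀] i) ξ‖ ∧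
    |l (initialValue v₀ u₁ θ₀ ξ 2)| ≤ ∑ i, ‖angularFourier (![v₀, u₁, θ₀] i) ξ‖ ∧
    |(l (initialValue v₀ u₁ θ₀ ξ 0) + l (initialValue v₀ u₁ θ₀ ξ 1)) / 2| ≤
      ∑ i, ‖angularFourier (![v₀, u₁, θ₀] i) ξ‖ := by
  have e₁ : (l (initialValue v₀ u₁ θ₀ ξ 1) - l (initialValue v₀ u₁ θ₀ ξ 0)) / 2 =
      -l (angularFourier v₀ ξ) := by
    simp [initialValue]; ring
  have e₃ : (l (initialValue v₀ u₁ θ₀ ξ 0) + l (initialValue v₀ u₁ θ₀ ξ 1)) / 2 =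
      l (angularFourier u₁ ξ) := by
    simp [initialValue]
  have e₂ : l (initialValue v₀ u₁ θ₀ ξ 2) = l (angularFourier θ₀ ξ) := by
    simp [initialValue]
  rw [e₁, e₂, e₃, abs_neg, Fin.sum_univ_three]
  simp only [Matrix.cons_val]
  have n₁ := norm_nonneg (angularFourier v₀ ξ)
  have n₂ := norm_nonneg (angularFourier u₁ ξ)
  have n₃ := norm_nonneg (angularFourier θ₀ ξ)
  refine ⟨(hl _).trans ?_, (hl _).trans ?_, (hl _).trans ?_⟩ <;> linarith

theorem dataNorm_eq_sum {n : ℕ} (p : ℝ≥0∞) (v₀ u₁ θ₀ : 𝓢(Rn n, ℂ)) :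
    dataNorm p v₀ u₁ θ₀ = ∑ i, eLpNorm (![v₀, u₁, θ₀] i) p volume := by
  rw [dataNorm, Fin.sum_univ_three]
  rfl

theorem rpow_le_quarter {r c : ℝ} (hr : 0 ≤ r) (hc : 0 < c) (h : r ≤ (1 / 4 : ℝ) ^ (1 / c)) :
    r ^ c ≤ 1 / 4 := by
  calc r ^ c ≤ ((1 / 4 : ℝ) ^ (1 / c)) ^ c := Real.rpow_le_rpow hr h hc.le
    _ = 1 / 4 := by
      rw [← Real.rpow_mul (by norm_num), one_div_mul_cancel hc.ne', Real.rpow_one]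

theorem DiagonalizesA0.mulVec_eq {S : Matrix (Fin 3) (Fin 3) ℂ} (hS : DiagonalizesA0 S)
    (x : Fin 3 → ℂ) : S *ᵥ (Matrix.diagonal yRoots *ᵥ x) = A0 *ᵥ (S *ᵥ x) := by
  have : S * Matrix.diagonal yRoots = A0 * S := by
    rw [← hS.2, ← Matrix.mul_assoc, ← Matrix.mul_assoc, Matrix.mul_nonsing_inv _ hS.1,
      Matrix.one_mul]
  rw [Matrix.mulVec_mulVec, this, Matrix.mulVec_mulVec]

theorem continuousOn_mulVec (S : Matrix (Fin 3) (Fin 3) ℂ) {f : ℝ → Fin 3 → ℂ} {s : Set ℝ}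
    (hf : ContinuousOn f s) : ContinuousOn (fun t => S *ᵥ f t) s :=
  (S.mulVecLin.toContinuousLinearMap.continuous).comp_continuousOn hf

theorem hasDerivAt_mulVec (S : Matrix (Fin 3) (Fin 3) ℂ) {f : ℝ → Fin 3 → ℂ} {f' : Fin 3 → ℂ}
    {t : ℝ} (hf : HasDerivAt f f' t) : HasDerivAt (fun t => S *ᵥ f t) (S *ᵥ f') t :=
  ((S.mulVecLin.toContinuousLinearMap).restrictScalars ℝ).hasFDerivAt.comp_hasDerivAt t hf

theorem norm_sub_le_weak {n : ℕ} {σ : ℝ} {v₀ u₁ θ₀ : 𝓢(Rn n, ℂ)} {w wt : ℝ → Rn n → Fin 3 → ℂ}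
    (hw : IsFourierSolution (symbolA σ) (initialValue v₀ u₁ θ₀) w)
    (hwt : IsFourierSolution (refSymbol σ)
      (fun ξ => ((T1half σ ‖ξ‖)⁻¹ * (T1 σ ‖ξ‖)⁻¹ * T0⁻¹) *ᵥ initialValue v₀ u₁ θ₀ ξ) wt)
    {ξ : Rn n} (hξ : 0 < ‖ξ‖) (h : ‖ξ‖ ^ (2 - 2 * σ) ≤ 1 / 4) {t : ℝ} (ht : 0 ≤ t) (j : Fin 3) :
    ‖(w t ξ - (T0 * T1 σ ‖ξ‖ * T1half σ ‖ξ‖) *ᵥ wt t ξ) j‖ ≤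
      160 * Real.exp 12 *
        (‖ξ‖ ^ (2 - 2 * σ) * Real.exp (-(1 / 32 * (‖ξ‖ ^ (4 - 2 * σ) * t)))) *
        ∑ i, ‖angularFourier (![v₀, u₁, θ₀] i) ξ‖ := by
  obtain ⟨w0, wc, wd⟩ := hw ξ
  obtain ⟨v0, vc, vd⟩ := hwt ξ
  have hinit : T0 *ᵥ ((T1 σ ‖ξ‖ * T1half σ ‖ξ‖) *ᵥ wt 0 ξ) = w 0 ξ := by
    rw [v0, w0]
    exact weak_transform_inverse_mulVec hξ h _
  rw [Matrix.mul_assoc, ← Matrix.mulVec_mulVec]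
  refine (norm_le_two_mul_of_comp_le fun l hl => ?_).trans_eq (b := 2 * (80 * Real.exp 12 *
    (‖ξ‖ ^ (2 - 2 * σ) * ∑ i, ‖angularFourier (![v₀, u₁, θ₀] i) ξ‖) *
      Real.exp (-(‖ξ‖ ^ (4 - 2 * σ) * t / 32)))) ?_
  · obtain ⟨b₁, b₂, b₃⟩ := comp_initialValue_bounds v₀ u₁ θ₀ ξ hl
    rw [← w0] at b₁ b₂ b₃
    exact abs_comp_sub_le_weak hξ h wc wd vc vd hinit l b₁ b₂ b₃ ht j
  · rw [show -(‖ξ‖ ^ (4 - 2 * σ) * t / 32) = -(1 / 32 * (‖ξ‖ ^ (4 - 2 * σ) * t)) by ring]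
    ring

/-- The diagonal system has complex coefficients, so real and imaginary parts of w̃ do not decouple.
Applying S first gives the system with the real matrix |ξ|²A₀, where they do, and removes S from the
bound. -/
theorem norm_sub_le_strong {n : ℕ} {σ : ℝ} {S : Matrix (Fin 3) (Fin 3) ℂ} (hS : DiagonalizesA0 S)
    {v₀ u₁ θ₀ : 𝓢(Rn n, ℂ)} {w wt : ℝ → Rn n → Fin 3 → ℂ}
    (hw : IsFourierSolution (symbolA σ) (initialValue v₀ u₁ θ₀) w)
    (hwt : IsFourierSolution refSymbolY (fun ξ => S⁻¹ *ᵥ initialValue v₀ u₁ θ₀ ξ) wt)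
    {ξ : Rn n} (hξ : 0 < ‖ξ‖) (h : ‖ξ‖ ^ (2 * σ - 2) ≤ 1 / 4) {t : ℝ} (ht : 0 ≤ t) (j : Fin 3) :
    ‖(w t ξ - S *ᵥ wt t ξ) j‖ ≤
      1256 * (‖ξ‖ ^ (2 * σ - 2) * Real.exp (-(1 / 128 * (‖ξ‖ ^ (2 : ℝ) * t)))) *
        ∑ i, ‖angularFourier (![v₀, u₁, θ₀] i) ξ‖ := by
  obtain ⟨w0, wc, wd⟩ := hw ξ
  obtain ⟨v0, vc, vd⟩ := hwt ξ
  have hinit : S *ᵥ wt 0 ξ = w 0 ξ := by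
    rw [v0, w0, Matrix.mulVec_mulVec, Matrix.mul_nonsing_inv _ hS.1, Matrix.one_mulVec]
  have hder : ∀ t, 0 < t → HasDerivAt (fun t => S *ᵥ wt t ξ)
      (-(((‖ξ‖ ^ 2 : ℝ) : ℂ) • (A0 *ᵥ (S *ᵥ wt t ξ)))) t := fun t ht =>
    (hasDerivAt_mulVec S (vd t ht)).congr_deriv (by
      rw [refSymbolY, Matrix.mulVec_neg, Matrix.smul_mulVec, Matrix.mulVec_smul, hS.mulVec_eq])
  refine (norm_le_two_mul_of_comp_le fun l hl => ?_).trans_eq (b := 2 * (628 *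
    (‖ξ‖ ^ (2 * σ - 2) * ∑ i, ‖angularFourier (![v₀, u₁, θ₀] i) ξ‖) *
      Real.exp (-(‖ξ‖ ^ 2 * t / 128)))) ?_
  · obtain ⟨b₁, b₂, b₃⟩ := comp_initialValue_bounds v₀ u₁ θ₀ ξ hl
    rw [← w0] at b₁ b₂ b₃
    exact abs_comp_sub_le_strong hξ h wc wd (continuousOn_mulVec S vc) hder hinit l b₁ b₂ b₃ ht j
  · rw [show -(‖ξ‖ ^ 2 * t / 128) = -(1 / 128 * (‖ξ‖ ^ (2 : ℝ) * t)) by rw [Real.rpow_two]; ring]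
    ring

theorem measurable_sub_weak {n : ℕ} {σ : ℝ} {v₀ u₁ θ₀ : 𝓢(Rn n, ℂ)}
    {w wt : ℝ → Rn n → Fin 3 → ℂ}
    (hw : IsFourierSolution (symbolA σ) (initialValue v₀ u₁ θ₀) w)
    (hwt : IsFourierSolution (refSymbol σ)
      (fun ξ => ((T1half σ ‖ξ‖)⁻¹ * (T1 σ ‖ξ‖)⁻¹ * T0⁻¹) *ᵥ initialValue v₀ u₁ θ₀ ξ) wt)
    {t : ℝ} (ht : 0 ≤ t) (j : Fin 3) :
    Measurable fun ξ => (w t ξ - (T0 * T1 σ ‖ξ‖ * T1half σ ‖ξ‖) *ᵥ wt t ξ) j := by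
  have hT1 : ∀ i j, Measurable fun ξ : Rn n => T1 σ ‖ξ‖ i j :=
    fun i j => (measurable_T1_entry σ i j).comp measurable_norm
  have hT1h : ∀ i j, Measurable fun ξ : Rn n => T1half σ ‖ξ‖ i j :=
    fun i j => (measurable_T1half_entry σ i j).comp measurable_norm
  have hinit := measurable_initialValue v₀ u₁ θ₀
  have hinv := measurable_mul_entry (N := fun ξ : Rn n => (T1half σ ‖ξ‖)⁻¹)
    (N' := fun ξ => (T1 σ ‖ξ‖)⁻¹) (measurable_inv_entry hT1h) (measurable_inv_entry hT1)
  have hinv' := measurable_mul_entry (N := fun ξ : Rn n => (T1half σ ‖ξ‖)⁻¹ * (T1 σ ‖ξ‖)⁻¹)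
    (N' := fun _ => T0⁻¹) hinv (fun _ _ => measurable_const)
  have hT := measurable_mul_entry (N := fun _ : Rn n => T0) (N' := fun ξ => T1 σ ‖ξ‖)
    (fun _ _ => measurable_const) hT1
  have hT' := measurable_mul_entry (N := fun ξ : Rn n => T0 * T1 σ ‖ξ‖) hT hT1h
  have hwt0 := measurable_mulVec (x := fun ξ => initialValue v₀ u₁ θ₀ ξ) hinv' hinit
  have hwtm := hwt.measurable (measurable_refSymbol_entry σ) hwt0 ht
  exact (hw.measurable (measurable_symbolA_entry σ) hinit ht j).sub
    (measurable_mulVec (x := fun ξ => wt t ξ) hT' hwtm j)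

theorem measurable_sub_strong {n : ℕ} {σ : ℝ} {S : Matrix (Fin 3) (Fin 3) ℂ}
    {v₀ u₁ θ₀ : 𝓢(Rn n, ℂ)} {w wt : ℝ → Rn n → Fin 3 → ℂ}
    (hw : IsFourierSolution (symbolA σ) (initialValue v₀ u₁ θ₀) w)
    (hwt : IsFourierSolution refSymbolY (fun ξ => S⁻¹ *ᵥ initialValue v₀ u₁ θ₀ ξ) wt)
    {t : ℝ} (ht : 0 ≤ t) (j : Fin 3) : Measurable fun ξ => (w t ξ - S *ᵥ wt t ξ) j := by
  have hinit := measurable_initialValue v₀ u₁ θ₀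
  have hwt0 := measurable_mulVec (N := fun _ : Rn n => S⁻¹)
    (x := fun ξ => initialValue v₀ u₁ θ₀ ξ) (fun _ _ => measurable_const) hinit
  have hwtm := hwt.measurable measurable_refSymbolY_entry hwt0 ht
  exact (hw.measurable (measurable_symbolA_entry σ) hinit ht j).sub
    (measurable_mulVec (N := fun _ : Rn n => S) (x := fun ξ => wt t ξ)
      (fun _ _ => measurable_const) hwtm j)

end ThermoPlate

/-! ### Assembly of the two regimes. -/

theorem mainTheorem12 :
    (∀ σ : ℝ, 0 ≤ σ → σ < 1 →
      ∃ ε : ℝ, 0 < ε ∧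
      ∀ (n : ℕ) (_ : 1 ≤ n) (s : ℝ) (_ : 0 ≤ s)
        (p q : ℝ≥0∞) (_ : 1 ≤ p) (_ : p ≤ 2) (_ : 2 ≤ q)
        (χ : ThermoPlate.Rn n → ℝ) (_ : ContDiff ℝ ∞ χ)
        (_ : tsupport χ ⊆ Metric.closedBall 0 ε),
      ∃ C : ℝ, 0 < C ∧
      ∀ (v₀ u₁ θ₀ : 𝓢(ThermoPlate.Rn n, ℂ))
        (w wt : ℝ → ThermoPlate.Rn n → Fin 3 → ℂ),
        ThermoPlate.IsFourierSolution (ThermoPlate.symbolA σ)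
          (ThermoPlate.initialValue v₀ u₁ θ₀) w →
        ThermoPlate.IsFourierSolution (ThermoPlate.refSymbol σ)
          (fun ξ => ((ThermoPlate.T1half σ ‖ξ‖)⁻¹ * (ThermoPlate.T1 σ ‖ξ‖)⁻¹ *
            ThermoPlate.T0⁻¹) *ᵥ ThermoPlate.initialValue v₀ u₁ θ₀ ξ) wt →
        ∀ t : ℝ, 0 ≤ t →
          (∀ j : Fin 3, Integrable (ThermoPlate.cutoffSymbol s χ
            (fun ξ => w t ξ - (ThermoPlate.T0 * ThermoPlate.T1 σ ‖ξ‖ *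
              ThermoPlate.T1half σ ‖ξ‖) *ᵥ wt t ξ) j) volume) ∧
          ThermoPlate.cutoffHomNorm s q χ
            (fun ξ => w t ξ - (ThermoPlate.T0 * ThermoPlate.T1 σ ‖ξ‖ *
              ThermoPlate.T1half σ ‖ξ‖) *ᵥ wt t ξ) ≤
          ENNReal.ofReal (C * (1 + t) ^
            (-(s / (4 - 2 * σ)) - n / (4 - 2 * σ) * ((p⁻¹).toReal - (q⁻¹).toReal)
              - (1 - σ) / (2 - σ))) *
            ThermoPlate.dataNorm p v₀ u₁ θ₀) ∧
    (∀ σ : ℝ, 1 < σ → σ ≤ 2 →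
      ∃ ε : ℝ, 0 < ε ∧
      ∀ (n : ℕ) (_ : 1 ≤ n) (s : ℝ) (_ : 0 ≤ s)
        (p q : ℝ≥0∞) (_ : 1 ≤ p) (_ : p ≤ 2) (_ : 2 ≤ q)
        (χ : ThermoPlate.Rn n → ℝ) (_ : ContDiff ℝ ∞ χ)
        (_ : tsupport χ ⊆ Metric.closedBall 0 ε),
      ∃ C : ℝ, 0 < C ∧
      ∀ (S : Matrix (Fin 3) (Fin 3) ℂ) (_ : ThermoPlate.DiagonalizesA0 S)
        (v₀ u₁ θ₀ : 𝓢(ThermoPlate.Rn n, ℂ))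
        (w wt : ℝ → ThermoPlate.Rn n → Fin 3 → ℂ),
        ThermoPlate.IsFourierSolution (ThermoPlate.symbolA σ)
          (ThermoPlate.initialValue v₀ u₁ θ₀) w →
        ThermoPlate.IsFourierSolution ThermoPlate.refSymbolY
          (fun ξ => S⁻¹ *ᵥ ThermoPlate.initialValue v₀ u₁ θ₀ ξ) wt →
        ∀ t : ℝ, 0 ≤ t →
          (∀ j : Fin 3, Integrable (ThermoPlate.cutoffSymbol s χ
            (fun ξ => w t ξ - S *ᵥ wt t ξ) j) volume) ∧
          ThermoPlate.cutoffHomNorm s q χ (fun ξ => w t ξ - S *ᵥ wt t ξ) ≤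
          ENNReal.ofReal (C * (1 + t) ^
            (-(s / 2) - n / 2 * ((p⁻¹).toReal - (q⁻¹).toReal) - (σ - 1))) *
            ThermoPlate.dataNorm p v₀ u₁ θ₀) := by
  constructor
  · intro σ hσ0 hσ1
    have hc : 0 < 2 - 2 * σ := by linarith
    -- This ε is the threshold at which δ = |ξ|^{2-2σ} reaches 1/4; it is also at most 1. The second
    -- regime uses the same choice with exponent 2σ-2.
    refine ⟨(1 / 4) ^ (1 / (2 - 2 * σ)), by positivity, fun n hn s hs p q hp1 hp hq χ hχ hsupp => ?_⟩
    obtain ⟨C, hC, h⟩ := ThermoPlate.exists_cutoffHomNorm_le hn (a := 4 - 2 * σ) (γ := 2 - 2 * σ)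
      (κ := 1 / 32) (K := 160 * Real.exp 12) (by linarith) hc.le (by norm_num) (by positivity) hs
      (Real.rpow_le_one (by norm_num) (by norm_num) (by positivity)) hp1 hp hq hχ hsupp
    refine ⟨C, hC, fun v₀ u₁ θ₀ w wt hw hwt t ht => ?_⟩
    have hexp : -(s / (4 - 2 * σ)) - n / (4 - 2 * σ) * ((p⁻¹).toReal - (q⁻¹).toReal)
        - (2 - 2 * σ) / (4 - 2 * σ) =
        -(s / (4 - 2 * σ)) - n / (4 - 2 * σ) * ((p⁻¹).toReal - (q⁻¹).toReal)
        - (1 - σ) / (2 - σ) := by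
      congr 1
      rw [div_eq_div_iff (by linarith) (by linarith)]
      ring
    rw [← hexp, ThermoPlate.dataNorm_eq_sum]
    refine h ![v₀, u₁, θ₀] _ t ht (fun j => ?_) (fun ξ hξ0 hξ j => ?_)
    · exact ThermoPlate.measurable_sub_weak hw hwt ht j
    · exact ThermoPlate.norm_sub_le_weak hw hwt hξ0 (ThermoPlate.rpow_le_quarter hξ0.le hc hξ) ht j
  · intro σ hσ1 hσ2
    have hc : 0 < 2 * σ - 2 := by linarith
    refine ⟨(1 / 4) ^ (1 / (2 * σ - 2)), by positivity, fun n hn s hs p q hp1 hp hq χ hχ hsupp => ?_⟩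
    obtain ⟨C, hC, h⟩ := ThermoPlate.exists_cutoffHomNorm_le hn (a := 2) (γ := 2 * σ - 2)
      (κ := 1 / 128) (K := 1256) le_rfl hc.le (by norm_num) (by positivity) hs
      (Real.rpow_le_one (by norm_num) (by norm_num) (by positivity)) hp1 hp hq hχ hsupp
    refine ⟨C, hC, fun S hS v₀ u₁ θ₀ w wt hw hwt t ht => ?_⟩
    have hexp : -(s / 2) - n / 2 * ((p⁻¹).toReal - (q⁻¹).toReal) - (2 * σ - 2) / 2 =
        -(s / 2) - n / 2 * ((p⁻¹).toReal - (q⁻¹).toReal) - (σ - 1) := by ring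
    rw [← hexp, ThermoPlate.dataNorm_eq_sum]
    refine h ![v₀, u₁, θ₀] _ t ht (fun j => ?_) (fun ξ hξ0 hξ j => ?_)
    · exact ThermoPlate.measurable_sub_strong hw hwt ht j
    · exact ThermoPlate.norm_sub_le_strong hS hw hwt hξ0
        (ThermoPlate.rpow_le_quarter hξ0.le hc hξ) ht j
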